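/- **Protocols.** Let $\mathcal A,\mathcal M,\mathcal B$ be finite-dimensional complex Hilbert spaces. For $n$ even, an $n$-message *weak coin flipping (WCF) protocol* consists of unit vectors $\psi_{A,0}\in\mathcal A$, $\psi_{M,0}\in\mathcal M$, $\psi_{B,0}\in\mathcal B$; unitaries $U_{A,i}$ and orthogonal projectors $E_{A,i}$ on $\mathcal A\otimes\mathcal M$ for odd $i\in\{1,\dots,n\}$; unitaries $U_{B,i}$ and orthogonal projectors $E_{B,i}$ on $\mathcal M\otimes\mathcal B$ for even $i\in\{1,\dots,n\}$; and two POVMs $\{\Pi_A^{(0)},\Pi_A^{(1)}\}$ on $\mathcal A$ and $\{\Pi_B^{(0)},\Pi_B^{(1)}\}$ on $\mathcal B$. Let $U_i=U_{A,i}\otimes I_{\mathcal B}$, $E_i=E_{A,i}\otimes I_{\mathcal B}$ for $i$ odd, $U_i=I_{\mathcal A}\otimes U_{B,i}$, $E_i=I_{\mathcal A}\otimes E_{B,i}$ for $i$ even, $\psi_0=\psi_{A,0}\otimes\psi_{M,0}\otimes\psi_{B,0}$ and $\psi_i=U_i\cdots U_1\psi_0$ (the honest states). It is required that $E_i\psi_i=\psi_i$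 for $1\le i\le n$, that $\Pi_A^{(0)}\otimes I\otimes\Pi_B^{(1)}\psi_n=\Pi_A^{(1)}\otimes I\otimes\Pi_B^{(0)}\psi_n=0$, and that $\|\Pi_A^{(0)}\otimes I\otimes\Pi_B^{(0)}\psi_n\|^2=\|\Pi_A^{(1)}\otimes I\otimes\Pi_B^{(1)}\psi_n\|^2=\tfrac12$. In odd rounds $i$ Alice applies $U_{A,i}$ and measures $\{E_{A,i},I-E_{A,i}\}$; in even rounds $i$ Bob applies $U_{B,i}$ and measures $\{E_{B,i},I-E_{B,i}\}$. On the second outcome the measuring player stops and declares himself or herself the winner. After round $n$ the players apply their POVMs; outcome $0$ means that Alice wins, outcome $1$ that Bob wins. **Cheating probabilities.** $P_B^*$ is the supremum, over all strategies of Bob, of the probability that honest Alice reaches the end and outputs $1$. In a strategy Bob has a workspace $\mathbb C^d$ of arbitrary finite dimension, initially in a unit vector of his choice (while $\mathcal A\otimes\mathcal M$ is initially in the state $\psi_{A,0}\otimes\psi_{M,0}$ prepared by Alice), and in every even round he applies an arbitrary unitary on $\mathcal M\otimes\mathbb C^d$. $\widehat P_B\ge P_B^*$ is the same supremum when Bob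 may moreover choose an arbitrary unit vector of $\mathcal M\otimes\mathbb C^d$ as initial state. $P_A^*$ is the supremum, over all strategies of Alice, of the probability that honest Bob reaches the end and outputs $0$; Alice has a workspace $\mathbb C^d$, chooses an arbitrary initial unit vector of $\mathbb C^d\otimes\mathcal M$ and applies in every odd round an arbitrary unitary on $\mathbb C^d\otimes\mathcal M$. **Dual feasible points.** Positive semidefinite matrices $Z_{A,0},\dots,Z_{A,n}$ on $\mathcal A$ form a *dual feasible point* with eigenvalue $\beta>0$ if $Z_{A,i-1}\otimes I_{\mathcal M}\succeq U_{A,i}^\dagger E_{A,i}(Z_{A,i}\otimes I_{\mathcal M})E_{A,i}U_{A,i}$ for $i$ odd, $Z_{A,i-1}=Z_{A,i}$ for $i$ even, $Z_{A,n}=\Pi_A^{(1)}$ and $Z_{A,0}\psi_{A,0}=\beta\psi_{A,0}$. Positive semidefinite matrices $Z_{B,0},\dots,Z_{B,n}$ on $\mathcal B$ form a *dual feasible point* with eigenvalue $\alpha>0$ if $I_{\mathcal M}\otimes Z_{B,i-1}\succeq U_{B,i}^\dagger E_{B,i}(I_{\mathcal M}\otimes Z_{B,i})E_{B,i}U_{B,i}$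 for $i$ even, $Z_{B,i-1}=Z_{B,i}$ for $i$ odd, $Z_{B,n}=\Pi_B^{(0)}$ and $Z_{B,0}\psi_{B,0}=\alpha\psi_{B,0}$. **Point games.** For a positive semidefinite matrix $Z$ let $\Pi_Z^{[z]}$ be the orthogonal projector onto its eigenspace for $z$ (zero if $z$ is not an eigenvalue). For $z,z_A,z_B\ge0$ put $\mathrm{prob}[Z,\psi](z)=\langle\psi|\Pi_Z^{[z]}|\psi\rangle$ and $\mathrm{prob}[Z_A,Z_B,\psi](z_A,z_B)=\langle\psi|\Pi_{Z_A}^{[z_A]}\otimes I_{\mathcal M}\otimes\Pi_{Z_B}^{[z_B]}|\psi\rangle$. A transition $l\to r$ of functions $[0,\infty)\to[0,\infty)$ with finite support is *EBM* if there are matrices $0\preceq X\preceq Y$ and a vector $\psi$ with $l=\mathrm{prob}[X,\psi]$ and $r=\mathrm{prob}[Y,\psi]$. A transition $p\to q$ of functions $[0,\infty)^2\to[0,\infty)$ with finite support is *EBM horizontal* if $p(\cdot,y)\to q(\cdot,y)$ is EBM for all $y\ge 0$, and *EBM vertical* if $p(x,\cdot)\to q(x,\cdot)$ is EBM for all $x\ge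 0$. Write $[x,y]$ for the function that is $1$ at $(x,y)$ and $0$ elsewhere. An *EBM point game with final point $[\beta,\alpha]$* is a sequence $p_0,\dots,p_m$ of functions $[0,\infty)^2\to[0,\infty)$ with finite support such that $p_0=\frac12[0,1]+\frac12[1,0]$, $p_m=[\beta,\alpha]$, and for $0\le i<m$ the transition $p_i\to p_{i+1}$ is EBM vertical if $i$ is even and EBM horizontal if $i$ is odd. **Proposition.** For every WCF protocol and every $\delta>0$: 1. There is an EBM point game with final point $[P_B^*+\delta,\,P_A^*+\delta]$. 2. There are dual feasible points $\{Z_{A,i}\}$ with eigenvalue $\beta=\widehat P_B+\delta$ and $\{Z_{B,i}\}$ with eigenvalue $\alpha=P_A^*+\delta$ such that the sequence $p_{n-i}=\mathrm{prob}[Z_{A,i},Z_{B,i},\psi_i]$, $0\le i\le n$, is an EBM point game with final point $[\beta,\alpha]$. -/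

import Mathlib

open scoped NNReal Kronecker Matrix ComplexOrder

namespace CoinFlip

noncomputable section

/-! ### Tensor products of three finite-dimensional spaces

A finite-dimensional Hilbert space with a fixed orthonormal basis is `ι → ℂ` for a finite type `ι`;
the space `𝒜 ⊗ ℳ ⊗ ℬ` is `A × M × B → ℂ`. -/

/-- `⟨v, w⟩`, conjugate-linear in the first argument. -/
def braket {ι : Type*} [Fintype ι] (v w : ι → ℂ) : ℂ := star v ⬝ᵥ w

/-- The squared Euclidean norm. -/
def sqNorm {ι : Type*} [Fintype ι] (v : ι → ℂ) : ℝ := ∑ i, ‖v i‖ ^ 2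

/-- The product vector `v ⊗ w`. -/
def tensorVec {ι κ : Type*} (v : ι → ℂ) (w : κ → ℂ) : ι × κ → ℂ := fun x => v x.1 * w x.2

/-- `X ⊗ 1_ℬ`, for `X` acting on `𝒜 ⊗ ℳ`. -/
def onAM {A M B : Type*} [DecidableEq B] (X : Matrix (A × M) (A × M) ℂ) :
    Matrix (A × M × B) (A × M × B) ℂ :=
  Matrix.reindex (Equiv.prodAssoc A M B) (Equiv.prodAssoc A M B) (X ⊗ₖ (1 : Matrix B B ℂ))

/-- `1_𝒜 ⊗ X`, for `X` acting on `ℳ ⊗ ℬ`. -/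
def onMB {A M B : Type*} [DecidableEq A] (X : Matrix (M × B) (M × B) ℂ) :
    Matrix (A × M × B) (A × M × B) ℂ :=
  (1 : Matrix A A ℂ) ⊗ₖ X

/-- `X ⊗ 1_ℳ ⊗ Y`, for `X` acting on `𝒜` and `Y` acting on `ℬ`. -/
def onAB {A M B : Type*} [DecidableEq M] (X : Matrix A A ℂ) (Y : Matrix B B ℂ) :
    Matrix (A × M × B) (A × M × B) ℂ :=
  X ⊗ₖ ((1 : Matrix M M ℂ) ⊗ₖ Y)

/-! ### Protocols -/

/-- The data of an `n`-message protocol on `𝒜 ⊗ ℳ ⊗ ℬ`. Rounds are numbered `1, …, n`. Only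
`UA i`, `EA i` with `i` odd and `UB i`, `EB i` with `i` even, `1 ≤ i ≤ n`, are used. -/
structure Protocol (A M B : Type*) where
  /-- number of messages -/
  n : ℕ
  /-- initial state of Alice's workspace -/
  ψA : A → ℂ
  /-- initial state of the message space -/
  ψM : M → ℂ
  /-- initial state of Bob's workspace -/
  ψB : B → ℂ
  /-- Alice's unitaries -/
  UA : ℕ → Matrix (A × M) (A × M) ℂ
  /-- Alice's projectors -/
  EA : ℕ → Matrix (A × M) (A × M) ℂ
  /-- Bob's unitaries -/
  UB : ℕ → Matrix (M × B) (M × B) ℂ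
  /-- Bob's projectors -/
  EB : ℕ → Matrix (M × B) (M × B) ℂ
  /-- Alice's final POVM element for the outcome 0 (Alice wins) -/
  FA0 : Matrix A A ℂ
  /-- Alice's final POVM element for the outcome 1 (Bob wins) -/
  FA1 : Matrix A A ℂ
  /-- Bob's final POVM element for the outcome 0 (Alice wins) -/
  FB0 : Matrix B B ℂ
  /-- Bob's final POVM element for the outcome 1 (Bob wins) -/
  FB1 : Matrix B B ℂ

variable {A M B : Type*} [Fintype A] [DecidableEq A] [Fintype M] [DecidableEq M]
  [Fintype B] [DecidableEq B]

namespace Protocol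

/-- `U_i` on the whole space. -/
def U (P : Protocol A M B) (i : ℕ) : Matrix (A × M × B) (A × M × B) ℂ :=
  if Odd i then onAM (P.UA i) else onMB (P.UB i)

/-- `E_i` on the whole space. -/
def E (P : Protocol A M B) (i : ℕ) : Matrix (A × M × B) (A × M × B) ℂ :=
  if Odd i then onAM (P.EA i) else onMB (P.EB i)

/-- The honest states `ψ_i = U_i ⋯ U_1 (ψ_A ⊗ ψ_M ⊗ ψ_B)`. -/
def honest (P : Protocol A M B) : ℕ → (A × M × B → ℂ)
  | 0 => tensorVec P.ψA (tensorVec P.ψM P.ψB)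
  | i + 1 => P.U (i + 1) *ᵥ P.honest i

/-- The protocol is a (correct, balanced) weak coin flipping protocol. -/
structure IsWCF (P : Protocol A M B) : Prop where
  even_n : Even P.n
  unit_ψA : sqNorm P.ψA = 1
  unit_ψM : sqNorm P.ψM = 1
  unit_ψB : sqNorm P.ψB = 1
  unitary_UA : ∀ i, Odd i → i ≤ P.n → P.UA i ∈ Matrix.unitaryGroup (A × M) ℂ
  unitary_UB : ∀ i, Even i → 0 < i → i ≤ P.n → P.UB i ∈ Matrix.unitaryGroup (M × B) ℂ
  proj_EA : ∀ i, Odd i → i ≤ P.n → IsStarProjection (P.EA i)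
  proj_EB : ∀ i, Even i → 0 < i → i ≤ P.n → IsStarProjection (P.EB i)
  E_honest : ∀ i, 0 < i → i ≤ P.n → P.E i *ᵥ P.honest i = P.honest i
  posSemidef_FA0 : P.FA0.PosSemidef
  posSemidef_FA1 : P.FA1.PosSemidef
  sum_FA : P.FA0 + P.FA1 = 1
  posSemidef_FB0 : P.FB0.PosSemidef
  posSemidef_FB1 : P.FB1.PosSemidef
  sum_FB : P.FB0 + P.FB1 = 1
  correct_01 : onAB P.FA0 P.FB1 *ᵥ P.honest P.n = 0
  correct_10 : onAB P.FA1 P.FB0 *ᵥ P.honest P.n = 0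
  balanced_A : sqNorm (onAB P.FA0 P.FB0 *ᵥ P.honest P.n) = 1 / 2
  balanced_B : sqNorm (onAB P.FA1 P.FB1 *ᵥ P.honest P.n) = 1 / 2

/-! ### Cheating

A cheating player has a workspace `ℂ^d` of arbitrary finite dimension and applies an arbitrary
unitary to it and the message space at each of his or her rounds. The honest player follows the
protocol; the state is kept unnormalized, so that its squared norm is the probability that the
honest player has not yet stopped the protocol (by declaring himself or herself the winner). -/

/-- The state after round `i` when Alice is honest and Bob applies `V i` at each even round `i`;
`ω` is the state of the message space and Bob's workspace before the first round. -/
def runB (P : Protocol A M B) {d : ℕ} (ω : M × Fin d → ℂ)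
    (V : ℕ → Matrix (M × Fin d) (M × Fin d) ℂ) : ℕ → (A × M × Fin d → ℂ)
  | 0 => tensorVec P.ψA ω
  | i + 1 =>
    if Odd (i + 1) then onAM (P.EA (i + 1) * P.UA (i + 1)) *ᵥ P.runB ω V i
    else onMB (V (i + 1)) *ᵥ P.runB ω V i

/-- The state after round `i` when Bob is honest and Alice applies `V i` at each odd round `i`;
`ω` is the state of Alice's workspace and the message space before the first round. -/
def runA (P : Protocol A M B) {d : ℕ} (ω : Fin d × M → ℂ)
    (V : ℕ → Matrix (Fin d × M) (Fin d × M) ℂ) : ℕ → (Fin d × M × B → ℂ)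
  | 0 => fun x => ω (x.1, x.2.1) * P.ψB x.2.2
  | i + 1 =>
    if Odd (i + 1) then onAM (V (i + 1)) *ᵥ P.runA ω V i
    else onMB (P.EB (i + 1) * P.UB (i + 1)) *ᵥ P.runA ω V i

/-- The probability that honest Alice outputs 1 against Bob's strategy. -/
def winB (P : Protocol A M B) {d : ℕ} (ω : M × Fin d → ℂ)
    (V : ℕ → Matrix (M × Fin d) (M × Fin d) ℂ) : ℝ :=
  (braket (P.runB ω V P.n) (onAB P.FA1 (1 : Matrix (Fin d) (Fin d) ℂ) *ᵥ P.runB ω V P.n)).re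

/-- The probability that honest Bob outputs 0 against Alice's strategy. -/
def winA (P : Protocol A M B) {d : ℕ} (ω : Fin d × M → ℂ)
    (V : ℕ → Matrix (Fin d × M) (Fin d × M) ℂ) : ℝ :=
  (braket (P.runA ω V P.n) (onAB (1 : Matrix (Fin d) (Fin d) ℂ) P.FB0 *ᵥ P.runA ω V P.n)).re

/-- Bob's optimal cheating probability `P_B^*`. Alice prepares the message space in the state `ψ_M`
before her first round; Bob prepares an arbitrary state of his workspace. -/
def optB (P : Protocol A M B) : ℝ :=
  sSup {p : ℝ | ∃ (d : ℕ) (χ : Fin d → ℂ) (V : ℕ → Matrix (M × Fin d) (M × Fin d) ℂ),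
    sqNorm χ = 1 ∧ (∀ i, V i ∈ Matrix.unitaryGroup (M × Fin d) ℂ) ∧
    p = P.winB (tensorVec P.ψM χ) V}

/-- Bob's optimal cheating probability when, in addition, he can access the message space before the
first round, so that he prepares an arbitrary joint state of the message space and his workspace.
This is the value of the semidefinite program in which the initial state `ρ` of `𝒜 ⊗ ℳ` is only
constrained by `tr_ℳ ρ = |ψ_A⟩⟨ψ_A|`. -/
def optBEarly (P : Protocol A M B) : ℝ :=
  sSup {p : ℝ | ∃ (d : ℕ) (ω : M × Fin d → ℂ) (V : ℕ → Matrix (M × Fin d) (M × Fin d) ℂ),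
    sqNorm ω = 1 ∧ (∀ i, V i ∈ Matrix.unitaryGroup (M × Fin d) ℂ) ∧
    p = P.winB ω V}

/-- Alice's optimal cheating probability `P_A^*`. Alice holds the message space before the first
round, so she prepares an arbitrary joint state of her workspace and the message space. -/
def optA (P : Protocol A M B) : ℝ :=
  sSup {p : ℝ | ∃ (d : ℕ) (ω : Fin d × M → ℂ) (V : ℕ → Matrix (Fin d × M) (Fin d × M) ℂ),
    sqNorm ω = 1 ∧ (∀ i, V i ∈ Matrix.unitaryGroup (Fin d × M) ℂ) ∧
    p = P.winA ω V}

/-! ### Dual feasible points -/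

/-- `Z_0, …, Z_n` is a dual feasible point bounding Bob's cheating, with eigenvalue `β`. -/
structure IsDualFeasibleA (P : Protocol A M B) (Z : ℕ → Matrix A A ℂ) (β : ℝ) : Prop where
  posSemidef : ∀ i ≤ P.n, (Z i).PosSemidef
  odd_step : ∀ i, Odd i → i ≤ P.n →
    (Z (i - 1) ⊗ₖ (1 : Matrix M M ℂ) -
      (P.UA i)ᴴ * P.EA i * (Z i ⊗ₖ (1 : Matrix M M ℂ)) * P.EA i * P.UA i).PosSemidef
  even_step : ∀ i, Even i → 0 < i → i ≤ P.n → Z (i - 1) = Z i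
  last : Z P.n = P.FA1
  pos : 0 < β
  eigen : Z 0 *ᵥ P.ψA = (β : ℂ) • P.ψA

/-- `Z_0, …, Z_n` is a dual feasible point bounding Alice's cheating, with eigenvalue `α`. -/
structure IsDualFeasibleB (P : Protocol A M B) (Z : ℕ → Matrix B B ℂ) (α : ℝ) : Prop where
  posSemidef : ∀ i ≤ P.n, (Z i).PosSemidef
  even_step : ∀ i, Even i → 0 < i → i ≤ P.n →
    ((1 : Matrix M M ℂ) ⊗ₖ Z (i - 1) -
      (P.UB i)ᴴ * P.EB i * ((1 : Matrix M M ℂ) ⊗ₖ Z i) * P.EB i * P.UB i).PosSemidef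
  odd_step : ∀ i, Odd i → i ≤ P.n → Z (i - 1) = Z i
  last : Z P.n = P.FB0
  pos : 0 < α
  eigen : Z 0 *ᵥ P.ψB = (α : ℂ) • P.ψB

end Protocol

/-! ### Point games -/

/-- The matrix of the orthogonal projection onto the eigenspace of `Z` for `z` (it is `0` if `z` is
not an eigenvalue). -/
def eigProj {ι : Type*} [Fintype ι] [DecidableEq ι] (Z : Matrix ι ι ℂ) (z : ℝ) : Matrix ι ι ℂ :=
  Matrix.toEuclideanLin.symm
    (Module.End.eigenspace (Matrix.toEuclideanLin Z) (z : ℂ)).starProjection.toLinearMap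

/-- `prob[Z, ψ]`. -/
def prob {ι : Type*} [Fintype ι] [DecidableEq ι] (Z : Matrix ι ι ℂ) (ψ : ι → ℂ) (z : ℝ≥0) : ℝ :=
  (braket ψ (eigProj Z z *ᵥ ψ)).re

/-- `prob[Z_A, Z_B, ψ]`. -/
def prob₂ (ZA : Matrix A A ℂ) (ZB : Matrix B B ℂ) (ψ : A × M × B → ℂ) (z : ℝ≥0 × ℝ≥0) : ℝ :=
  (braket ψ (onAB (eigProj ZA z.1) (eigProj ZB z.2) *ᵥ ψ)).re

/-- The line transition `l → r` is expressible by matrices. -/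
def EBMLine (l r : ℝ≥0 → ℝ) : Prop :=
  ∃ (d : ℕ) (X Y : Matrix (Fin d) (Fin d) ℂ) (ψ : Fin d → ℂ),
    X.PosSemidef ∧ (Y - X).PosSemidef ∧ l = prob X ψ ∧ r = prob Y ψ

/-- EBM horizontal transition: the first coordinate moves. -/
def EBMHorizontal (p q : ℝ≥0 × ℝ≥0 → ℝ) : Prop :=
  ∀ y, EBMLine (fun x => p (x, y)) (fun x => q (x, y))

/-- EBM vertical transition: the second coordinate moves. -/
def EBMVertical (p q : ℝ≥0 × ℝ≥0 → ℝ) : Prop :=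
  ∀ x, EBMLine (fun y => p (x, y)) (fun y => q (x, y))

/-- The function `[x, y]`, equal to `1` at `(x, y)` and to `0` elsewhere. -/
def point (x y : ℝ≥0) : ℝ≥0 × ℝ≥0 → ℝ := fun z => if z = (x, y) then 1 else 0

/-- `p_0, …, p_n` is an EBM point game with final point `[β, α]`. -/
structure IsEBMPointGame (n : ℕ) (p : ℕ → ℝ≥0 × ℝ≥0 → ℝ) (β α : ℝ≥0) : Prop where
  nonneg : ∀ i ≤ n, ∀ z, 0 ≤ p i z
  finite_support : ∀ i ≤ n, (Function.support (p i)).Finite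
  init : p 0 = (1 / 2 : ℝ) • point 0 1 + (1 / 2 : ℝ) • point 1 0
  vertical : ∀ i < n, Even i → EBMVertical (p i) (p (i + 1))
  horizontal : ∀ i < n, Odd i → EBMHorizontal (p i) (p (i + 1))
  final : p n = point β α

end

end CoinFlip

/-! The proof combines strong duality for the cheating problems with a dilation that turns strict
dual inequalities into EBM transitions.

Duality. Against a fixed honest player the adversary applies one unitary before each honest
operation. If every strictly feasible dual sequence has initial expectation at least `t`, the
adversary can reach `t`. One round is handled by separating convex sets: this gives a state `ρ`
whose marginal on the honest workspace is prescribed and which is good against all dual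
continuations of the later rounds simultaneously, because these form a convex set. Purifications of
the same marginal differ by a unitary on the purifying system, so the adversary can produce a
purification of `ρ` (`exists_unitary_forall_le`), and induction treats all rounds
(`exists_unitary_le_chainRun`). Hence every number above the optimal cheating probability exceeds
the initial expectation of some strictly feasible sequence. Enlarging the first matrix makes the
initial state an exact eigenvector (`exists_eigen_majorant`).

Dilation. A dual constraint compares `Y` with a compression of `Z`, whereas EBM needs matrices
ordered on one space with one common vector. Embedding into a doubled space makes the compression a
corner, and a Schur complement then dominates the whole block matrix at no cost to the vector
(`EBMLine.of_compression`); strictness is what makes this possible. Operations of one player commute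
with the spectral projectors of the other player's matrix, so the transition holds in every row or
column. Correctness and balance of the protocol fix the first point configuration
(`IsWCF.prob₂_init`), and the product form of the initial state fixes the last
(`IsWCF.prob₂_final`).

For the bound by `optB`, Bob cannot touch the message space before round 1, so duality is used only
from the honest state after round 1 on. The missing last step compresses onto that single vector and
merges all points at once (`IsWCF.ebmHorizontal_point`). -/

namespace CoinFlip

set_option linter.unusedSectionVars false

/-! ### Positivity, Schur complements and unitary equivalence of purifications -/

section LinearAlgebra

open scoped MatrixOrder Matrix.Norms.L2Operator

variable {ι κ : Type*} [Fintype ι] [DecidableEq ι] [Fintype κ] [DecidableEq κ]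

theorem exists_smul_one_sub_posDef {X : Matrix ι ι ℂ} (hX : X.IsHermitian) :
    ∃ c : ℝ, 0 < c ∧ ((c : ℂ) • (1 : Matrix ι ι ℂ) - X).PosDef := by
  have h : X ≤ algebraMap ℝ (Matrix ι ι ℂ) ‖X‖ :=
    IsSelfAdjoint.le_algebraMap_norm_self (a := X) hX
  refine ⟨‖X‖ + 1, by positivity, ?_⟩
  have h2 : (algebraMap ℝ (Matrix ι ι ℂ) ‖X‖ - X).PosSemidef := h
  have h3 := Matrix.PosDef.one.add_posSemidef h2
  convert h3 using 1
  rw [Algebra.algebraMap_eq_smul_one]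
  ext i j
  simp [Matrix.one_apply]
  split_ifs <;> ring

/-- Testing only the Hermitian part gives a cone that is open in the space of all matrices, so that
Hahn–Banach separation can be used without passing to the subspace of Hermitian ones. -/
theorem isOpen_setOf_add_conjTranspose_posDef :
    IsOpen {X : Matrix ι ι ℂ | (X + Xᴴ).PosDef} := by
  rcases subsingleton_or_nontrivial (Matrix ι ι ℂ) with _ | _
  · exact isOpen_discrete _
  rw [Metric.isOpen_iff]
  intro X hX
  have hX' : (X + Xᴴ).PosDef := hX
  obtain ⟨r, hr, hrX⟩ := (CFC.exists_pos_algebraMap_le_iff (A := Matrix ι ι ℂ)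
    (a := X + Xᴴ) hX'.isHermitian).2 fun x hx => hX'.isStrictlyPositive.spectrum_pos hx
  -- A perturbation `D` of norm below `r / 2` changes `X + Xᴴ` by `D + Dᴴ`, of norm below the
  -- spectral gap `r`.
  refine ⟨r / 2, by positivity, fun Y hY => ?_⟩
  have hD : ‖X - Y‖ < r / 2 := by rwa [← dist_eq_norm, dist_comm]
  set D := X - Y with hDdef
  have hDD : ‖D + Dᴴ‖ < r := by
    have h1 : ‖Dᴴ‖ = ‖D‖ := norm_star D
    have := norm_add_le D Dᴴ
    linarith
  have hDh : (D + Dᴴ).IsHermitian := Matrix.isHermitian_add_transpose_self D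
  have h1 : (algebraMap ℝ (Matrix ι ι ℂ) ‖D + Dᴴ‖ - (D + Dᴴ)).PosSemidef :=
    IsSelfAdjoint.le_algebraMap_norm_self (a := D + Dᴴ) hDh
  have h2 : (X + Xᴴ - algebraMap ℝ (Matrix ι ι ℂ) r).PosSemidef := hrX
  have h3 : (((r - ‖D + Dᴴ‖ : ℝ) : ℂ) • (1 : Matrix ι ι ℂ)).PosDef :=
    Matrix.PosDef.one.smul (by exact_mod_cast sub_pos.2 hDD)
  have h4 := (h3.add_posSemidef h1).add_posSemidef h2
  show (Y + Yᴴ).PosDef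
  convert h4 using 1
  have : Y = X - D := by simp [hDdef]
  rw [this, Algebra.algebraMap_eq_smul_one, Algebra.algebraMap_eq_smul_one]
  ext i j
  simp [Matrix.one_apply]
  split_ifs <;> simp <;> ring

/-- Since `P` is invertible, the Schur complement `c - R - Qᴴ P⁻¹ Q` decides positivity, and a large
`c` makes it positive. -/
theorem exists_fromBlocks_posSemidef {P : Matrix ι ι ℂ} (hP : P.PosDef) (Q : Matrix ι κ ℂ)
    {R : Matrix κ κ ℂ} (hR : R.IsHermitian) :
    ∃ c : ℝ, 0 < c ∧ (Matrix.fromBlocks P Q Qᴴ ((c : ℂ) • 1 - R)).PosSemidef := by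
  obtain ⟨c, hc, h⟩ := exists_smul_one_sub_posDef (X := R + Qᴴ * P⁻¹ * Q)
    (hR.add (Matrix.isHermitian_conjTranspose_mul_mul _ hP.inv.isHermitian))
  refine ⟨c, hc, ?_⟩
  have := hP.isUnit.invertible
  rw [Matrix.PosDef.fromBlocks₁₁ _ _ hP]
  rw [sub_sub]
  exact h.posSemidef

/-- The hypothesis says that `Φᴴ x` and `Χᴴ x` always have equal norm, so `Φᴴ x ↦ Χᴴ x` is a
well-defined isometry on the range of `Φᴴ` and extends to the whole space. With `Φ`, `Χ` read as
coefficient matrices of bipartite vectors, this is the unitary freedom of purifications. -/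
theorem exists_unitary_mul_eq {Φ Χ : Matrix ι κ ℂ} (h : Φ * Φᴴ = Χ * Χᴴ) :
    ∃ W ∈ Matrix.unitaryGroup κ ℂ, Χ = Φ * W := by
  let T := Matrix.toEuclideanLin Φᴴ
  let T' := Matrix.toEuclideanLin Χᴴ
  have hn : ∀ x, ‖T x‖ = ‖T' x‖ := by
    intro x
    have key : ∀ Ψ : Matrix ι κ ℂ, inner ℂ (Matrix.toEuclideanLin Ψᴴ x)
        (Matrix.toEuclideanLin Ψᴴ x) = star x.ofLp ⬝ᵥ ((Ψ * Ψᴴ) *ᵥ x.ofLp) := by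
      intro Ψ
      rw [EuclideanSpace.inner_eq_star_dotProduct, ← Matrix.mulVec_mulVec,
        Matrix.dotProduct_mulVec, dotProduct_comm, Matrix.ofLp_toLpLin, Matrix.toLin'_apply,
        Matrix.star_mulVec, Matrix.conjTranspose_conjTranspose]
    have h1 := key Φ
    rw [h, ← key Χ, inner_self_eq_norm_sq_to_K, inner_self_eq_norm_sq_to_K] at h1
    have h2 : ‖T x‖ ^ 2 = ‖T' x‖ ^ 2 := by exact_mod_cast h1
    exact (sq_eq_sq₀ (norm_nonneg _) (norm_nonneg _)).1 h2
  -- The choice of preimages `f` is harmless: by `hn`, `T'` vanishes on the kernel of `T`.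
  obtain ⟨f, hf⟩ := T.rangeRestrict.exists_rightInverse_of_surjective T.range_rangeRestrict
  have hf' : ∀ s, T (f s) = s := fun s => congrArg Subtype.val (LinearMap.congr_fun hf s)
  let L : LinearMap.range T →ₗᵢ[ℂ] EuclideanSpace ℂ κ :=
    ⟨T' ∘ₗ f, fun s => by
      rw [LinearMap.comp_apply, ← hn, hf' s, Submodule.coe_norm]⟩
  have hL : ∀ x, L.extend (T x) = T' x := by
    intro x
    have h0 : L.extend (T x) = L (T.rangeRestrict x) := L.extend_apply (T.rangeRestrict x)
    rw [h0, ← sub_eq_zero, ← norm_eq_zero]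
    have h1 : L (T.rangeRestrict x) - T' x = T' (f (T.rangeRestrict x) - x) := by
      rw [map_sub]; rfl
    rw [h1, ← hn, map_sub, hf']
    simp
  let V : Matrix κ κ ℂ := Matrix.toEuclideanLin.symm L.extend.toLinearMap
  have hV : ∀ v, Matrix.toEuclideanLin V v = L.extend v := fun v => by simp [V]
  have hVΦ : V * Φᴴ = Χᴴ := by
    refine Matrix.ext_iff_mulVec.2 fun x => ?_
    rw [← Matrix.mulVec_mulVec]
    have h1 := hL (WithLp.toLp 2 x)
    rw [← hV] at h1
    exact congrArg WithLp.ofLp h1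
  have hVV : Vᴴ * V = 1 := by
    ext i j
    have hcol : ∀ k, WithLp.toLp 2 (Vᵀ k) = L.extend (EuclideanSpace.single k 1) := by
      intro k
      rw [← hV]
      ext l
      simp [Matrix.toLpLin_apply]
    rw [← inner_matrix_col_col, hcol, hcol, LinearIsometry.inner_map_map]
    simp [EuclideanSpace.inner_single_left, Matrix.one_apply]
  refine ⟨Vᴴ, ?_, ?_⟩
  · rw [Matrix.mem_unitaryGroup_iff, Matrix.star_eq_conjTranspose,
      Matrix.conjTranspose_conjTranspose]
    exact hVV
  · rw [← Matrix.conjTranspose_conjTranspose Χ, ← hVΦ, Matrix.conjTranspose_mul,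
      Matrix.conjTranspose_conjTranspose]

end LinearAlgebra

/-! ### Eigenprojections and spectral distributions -/

section EigenProjection

theorem star_mulVec_dotProduct {ι κ : Type*} [Fintype ι] [Fintype κ] (X : Matrix κ ι ℂ)
    (v : ι → ℂ) (w : κ → ℂ) : star (X *ᵥ v) ⬝ᵥ w = star v ⬝ᵥ (Xᴴ *ᵥ w) := by
  rw [Matrix.star_mulVec, Matrix.dotProduct_mulVec]

variable {ι κ : Type*} [Fintype ι] [DecidableEq ι] [Fintype κ] [DecidableEq κ]

theorem eigProj_mulVec (Z : Matrix ι ι ℂ) (z : ℝ) (v : ι → ℂ) :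
    eigProj Z z *ᵥ v = ((Module.End.eigenspace (Matrix.toEuclideanLin Z) (z : ℂ)).starProjection
      (WithLp.toLp 2 v)).ofLp := by
  have h : Matrix.toEuclideanLin (eigProj Z z) =
    (Module.End.eigenspace (Matrix.toEuclideanLin Z) (z : ℂ)).starProjection.toLinearMap := by
    simp [eigProj]
  exact congrArg WithLp.ofLp (LinearMap.congr_fun h (WithLp.toLp 2 v))

theorem mem_eigenspace_toEuclideanLin {Z : Matrix ι ι ℂ} {z : ℂ} {v : EuclideanSpace ℂ ι} :
    v ∈ Module.End.eigenspace (Matrix.toEuclideanLin Z) z ↔ Z *ᵥ v.ofLp = z • v.ofLp := by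
  rw [Module.End.mem_eigenspace_iff]
  exact (WithLp.ofLp_injective 2).eq_iff.symm

theorem mulVec_eigProj_mulVec (Z : Matrix ι ι ℂ) (z : ℝ) (v : ι → ℂ) :
    Z *ᵥ (eigProj Z z *ᵥ v) = (z : ℂ) • (eigProj Z z *ᵥ v) := by
  rw [eigProj_mulVec, ← mem_eigenspace_toEuclideanLin]
  exact Submodule.starProjection_apply_mem _ _

theorem eigProj_mulVec_eq {Z : Matrix ι ι ℂ} {z : ℝ} {u v : ι → ℂ}
    (hu : Z *ᵥ u = (z : ℂ) • u)
    (ho : ∀ w, Z *ᵥ w = (z : ℂ) • w → star w ⬝ᵥ (v - u) = 0) : eigProj Z z *ᵥ v = u := by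
  rw [eigProj_mulVec, Submodule.eq_starProjection_of_mem_of_inner_eq_zero
    (v := WithLp.toLp 2 u) (mem_eigenspace_toEuclideanLin.2 hu)]
  intro w hw
  rw [inner_eq_zero_symm, EuclideanSpace.inner_eq_star_dotProduct, dotProduct_comm]
  exact ho _ (mem_eigenspace_toEuclideanLin.1 hw)

theorem eigProj_mulVec_of_eigen {Z : Matrix ι ι ℂ} {z : ℝ} {v : ι → ℂ}
    (hv : Z *ᵥ v = (z : ℂ) • v) : eigProj Z z *ᵥ v = v :=
  eigProj_mulVec_eq hv (by simp)

theorem mul_eigProj (Z : Matrix ι ι ℂ) (z : ℝ) : Z * eigProj Z z = (z : ℂ) • eigProj Z z := by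
  refine Matrix.ext_iff_mulVec.2 fun x => ?_
  rw [← Matrix.mulVec_mulVec, mulVec_eigProj_mulVec, Matrix.smul_mulVec]

theorem eigProj_isHermitian (Z : Matrix ι ι ℂ) (z : ℝ) : (eigProj Z z).IsHermitian := by
  rw [← Matrix.isSymmetric_toEuclideanLin_iff]
  have h : Matrix.toEuclideanLin (eigProj Z z) =
    (Module.End.eigenspace (Matrix.toEuclideanLin Z) (z : ℂ)).starProjection.toLinearMap := by
    simp [eigProj]
  rw [h]
  exact Submodule.starProjection_isSymmetric _

theorem eigProj_mul_self (Z : Matrix ι ι ℂ) (z : ℝ) :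
    eigProj Z z * eigProj Z z = eigProj Z z := by
  refine Matrix.ext_iff_mulVec.2 fun x => ?_
  rw [← Matrix.mulVec_mulVec]
  exact eigProj_mulVec_of_eigen (mulVec_eigProj_mulVec _ _ _)

theorem eigProj_mul {Z : Matrix ι ι ℂ} (hZ : Z.IsHermitian) (z : ℝ) :
    eigProj Z z * Z = (z : ℂ) • eigProj Z z := by
  have h := congrArg Matrix.conjTranspose (mul_eigProj Z z)
  rwa [Matrix.conjTranspose_mul, Matrix.conjTranspose_smul, hZ.eq, (eigProj_isHermitian Z z).eq,
    Complex.star_def, Complex.conj_ofReal] at h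

theorem eigProj_posSemidef (Z : Matrix ι ι ℂ) (z : ℝ) : (eigProj Z z).PosSemidef := by
  have h := Matrix.posSemidef_conjTranspose_mul_self (eigProj Z z)
  rwa [(eigProj_isHermitian Z z).eq, eigProj_mul_self] at h

theorem eigProj_mulVec_of_ne {Z : Matrix ι ι ℂ} (hZ : Z.IsHermitian) {x z : ℝ} (hxz : x ≠ z)
    {v : ι → ℂ} (hv : Z *ᵥ v = (z : ℂ) • v) : eigProj Z x *ᵥ v = 0 := by
  have h1 : (z : ℂ) • (eigProj Z x *ᵥ v) = (x : ℂ) • (eigProj Z x *ᵥ v) := by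
    rw [← Matrix.mulVec_smul, ← hv, Matrix.mulVec_mulVec, eigProj_mul hZ, Matrix.smul_mulVec]
  rw [← sub_eq_zero, ← sub_smul, smul_eq_zero, sub_eq_zero] at h1
  exact h1.resolve_left fun h => hxz (by exact_mod_cast h.symm)

theorem finite_setOf_eigProj_ne_zero (Z : Matrix ι ι ℂ) :
    {z : ℝ≥0 | eigProj Z z ≠ 0}.Finite := by
  have h := Module.End.finite_hasEigenvalue (Matrix.toEuclideanLin Z)
  refine (h.preimage (f := fun z : ℝ≥0 => ((z : ℝ) : ℂ)) ?_).subset ?_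
  · intro a _ b _ hab
    simpa using hab
  · intro z hz
    simp only [Set.mem_preimage, Set.mem_ofPred_eq, Module.End.hasEigenvalue_iff]
    intro h0
    apply hz
    simp [eigProj, h0]

/-- `W` is only an isometry, so at `z = 0` the conjugated matrix has extra kernel; it is orthogonal
to the range of `W` and is not seen. In general `Wᴴ` maps eigenvectors of `W * Z * Wᴴ` to
eigenvectors of `Z` (or to zero), which gives the required orthogonality. -/
theorem eigProj_conj_mulVec {W : Matrix κ ι ℂ} (hW : Wᴴ * W = 1) (Z : Matrix ι ι ℂ) (z : ℝ)
    (v : ι → ℂ) : eigProj (W * Z * Wᴴ) z *ᵥ (W *ᵥ v) = W *ᵥ (eigProj Z z *ᵥ v) := by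
  have hW' : ∀ u, Wᴴ *ᵥ (W *ᵥ u) = u := fun u => by rw [Matrix.mulVec_mulVec, hW, Matrix.one_mulVec]
  apply eigProj_mulVec_eq
  · rw [← Matrix.mulVec_mulVec, ← Matrix.mulVec_mulVec, hW', mulVec_eigProj_mulVec,
      Matrix.mulVec_smul]
  · intro w hw
    have hw' : Z *ᵥ (Wᴴ *ᵥ w) = (z : ℂ) • (Wᴴ *ᵥ w) := by
      rw [← Matrix.mulVec_smul, ← hw, ← Matrix.mulVec_mulVec, ← Matrix.mulVec_mulVec, hW']
    have h1 := eigProj_mulVec_of_eigen hw'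
    rw [← Matrix.mulVec_sub, ← Matrix.conjTranspose_conjTranspose W, ← star_mulVec_dotProduct, ← h1,
      star_mulVec_dotProduct, (eigProj_isHermitian Z z).eq, Matrix.mulVec_sub,
      Matrix.mulVec_mulVec, eigProj_mul_self, sub_self, dotProduct_zero]

theorem prob_conj {W : Matrix κ ι ℂ} (hW : Wᴴ * W = 1) (Z : Matrix ι ι ℂ) (v : ι → ℂ) :
    prob (W * Z * Wᴴ) (W *ᵥ v) = prob Z v := by
  funext z
  rw [prob, prob, braket, braket, eigProj_conj_mulVec hW, Matrix.star_mulVec,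
    ← Matrix.dotProduct_mulVec, Matrix.mulVec_mulVec _ Wᴴ, hW, Matrix.one_mulVec]

end EigenProjection

/-! ### From compressions to EBM transitions -/

section Dilation

variable {ι κ : Type*} [Fintype ι] [DecidableEq ι] [Fintype κ] [DecidableEq κ]

/-- Enumerating the basis moves the matrices to some `Fin d`, as `EBMLine` demands. -/
theorem EBMLine.of_posSemidef {X Y : Matrix ι ι ℂ} (hX : X.PosSemidef) (hXY : (Y - X).PosSemidef)
    (ψ : ι → ℂ) : EBMLine (prob X ψ) (prob Y ψ) := by
  let e := (Fintype.equivFin ι).symm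
  let W : Matrix (Fin (Fintype.card ι)) ι ℂ := (1 : Matrix ι ι ℂ).submatrix e id
  have hW : Wᴴ * W = 1 := by
    rw [Matrix.conjTranspose_submatrix, Matrix.submatrix_mul_equiv, Matrix.conjTranspose_one,
      one_mul, Matrix.submatrix_id_id]
  refine ⟨_, W * X * Wᴴ, W * Y * Wᴴ, W *ᵥ ψ, hX.mul_mul_conjTranspose_same W, ?_,
    (prob_conj hW X ψ).symm, (prob_conj hW Y ψ).symm⟩
  rw [← Matrix.sub_mul, ← Matrix.mul_sub]
  exact hXY.mul_mul_conjTranspose_same W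

theorem prob_fromBlocks_elim_zero (X : Matrix ι ι ℂ) (Y : Matrix κ κ ℂ) (φ : ι → ℂ) :
    prob (Matrix.fromBlocks X 0 0 Y) (Sum.elim φ 0) = prob X φ := by
  funext z
  have h : eigProj (Matrix.fromBlocks X 0 0 Y) z *ᵥ Sum.elim φ 0
      = Sum.elim (eigProj X z *ᵥ φ) 0 := by
    apply eigProj_mulVec_eq
    · rw [Matrix.fromBlocks_mulVec]
      ext (i | i) <;> simp [mul_eigProj, Matrix.smul_mulVec]
    · intro w hw
      have hw1 : X *ᵥ (w ∘ Sum.inl) = ((z : ℝ) : ℂ) • (w ∘ Sum.inl) := by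
        have h := congrArg (fun u => u ∘ Sum.inl) hw
        rw [Matrix.fromBlocks_mulVec] at h
        simp only [Matrix.zero_mulVec, add_zero, Sum.elim_comp_inl] at h
        exact h
      have h1 : star (w ∘ Sum.inl) ⬝ᵥ (φ - eigProj X z *ᵥ φ) = 0 := by
        rw [← eigProj_mulVec_of_eigen hw1, star_mulVec_dotProduct, (eigProj_isHermitian X z).eq,
          Matrix.mulVec_sub, Matrix.mulVec_mulVec, eigProj_mul_self, sub_self, dotProduct_zero]
      simpa [dotProduct, Fintype.sum_sum_type] using h1
  rw [prob, prob, braket, braket, h]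
  simp [dotProduct, Fintype.sum_sum_type]

/-- A strict inequality between a compression of `Z` and `Y` yields an EBM transition: dilate the
space so that the compression becomes a corner. -/
theorem EBMLine.of_compression {Z Y U E : Matrix ι ι ℂ} {φ : ι → ℂ} (hZ : Z.PosSemidef)
    (hU : U ∈ Matrix.unitaryGroup ι ℂ) (hE : IsStarProjection E) (hφ : E *ᵥ (U *ᵥ φ) = U *ᵥ φ)
    (h : (Y - Uᴴ * E * Z * E * U).PosDef) : EBMLine (prob Z (U *ᵥ φ)) (prob Y φ) := by
  have hEh : Eᴴ = E := hE.isSelfAdjoint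
  have hEE : E * E = E := hE.isIdempotentElem
  have hUU : U * Uᴴ = 1 := Matrix.mem_unitaryGroup_iff.1 hU
  have hUU' : Uᴴ * U = 1 := Matrix.mem_unitaryGroup_iff'.1 hU
  -- `W` splits a vector into its `E` part, rotated back by `Uᴴ`, and the rest. It is an isometry
  -- and sends `U *ᵥ φ` to `(φ, 0)`, since `E` fixes `U *ᵥ φ`.
  let W : Matrix (ι ⊕ ι) ι ℂ := Matrix.fromRows (Uᴴ * E) (1 - E)
  have hWh : Wᴴ = Matrix.fromCols (E * U) (1 - E) := by
    simp [W, Matrix.conjTranspose_fromRows_eq_fromCols_conjTranspose, hEh]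
  have hW : Wᴴ * W = 1 := by
    rw [hWh, Matrix.fromCols_mul_fromRows]
    have : E * U * (Uᴴ * E) = E := by
      rw [Matrix.mul_assoc, ← Matrix.mul_assoc U, hUU, Matrix.one_mul, hEE]
    rw [this, Matrix.mul_sub, Matrix.sub_mul, Matrix.sub_mul, hEE]
    simp
  have hWφ : W *ᵥ (U *ᵥ φ) = Sum.elim φ 0 := by
    rw [Matrix.fromRows_mulVec, ← Matrix.mulVec_mulVec, hφ, Matrix.sub_mulVec, hφ,
      Matrix.one_mulVec, sub_self, Matrix.mulVec_mulVec, hUU', Matrix.one_mulVec]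
  have hX : W * Z * Wᴴ = Matrix.fromBlocks (Uᴴ * E * Z * E * U) (Uᴴ * E * Z * (1 - E))
      ((1 - E) * Z * E * U) ((1 - E) * Z * (1 - E)) := by
    rw [hWh, Matrix.fromRows_mul, Matrix.fromRows_mul_fromCols]
    simp only [Matrix.mul_assoc]
  -- The upper left corner of `W * Z * Wᴴ` is the given compression, strictly below `Y`. The number
  -- `c` may be as large as needed: it enters only the second block, where `(φ, 0)` has no weight.
  obtain ⟨c, -, hc⟩ := exists_fromBlocks_posSemidef h (-(Uᴴ * E * Z * (1 - E)))
    (R := (1 - E) * Z * (1 - E)) (by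
      rw [Matrix.IsHermitian, Matrix.conjTranspose_mul, Matrix.conjTranspose_mul,
        hZ.isHermitian.eq, Matrix.conjTranspose_sub, hEh, Matrix.conjTranspose_one,
        Matrix.mul_assoc])
  have key := EBMLine.of_posSemidef (X := W * Z * Wᴴ)
    (Y := Matrix.fromBlocks Y 0 0 ((c : ℂ) • 1)) (hZ.mul_mul_conjTranspose_same W) (by
      rw [hX, sub_eq_add_neg, Matrix.fromBlocks_neg, Matrix.fromBlocks_add]
      convert hc using 2 <;>
        simp [sub_eq_add_neg, hEh, hZ.isHermitian.eq, Matrix.mul_assoc]) (W *ᵥ (U *ᵥ φ))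
  rwa [prob_conj hW, hWφ, prob_fromBlocks_elim_zero] at key

end Dilation

/-! ### Separation argument for one round -/

section Duality

/-- Let `ε` tend to infinity for the first claim and to zero for the second. This extracts
homogeneous inequalities from a bound on a cone. -/
theorem nonpos_and_le_of_forall_pos {a b u : ℝ} (h : ∀ ε : ℝ, 0 < ε → ε * a + b ≤ u) :
    a ≤ 0 ∧ b ≤ u := by
  constructor
  · by_contra! ha
    have h1 := h ((|u - b| + 1) / a) (by positivity)
    rw [div_mul_cancel₀ _ ha.ne'] at h1
    linarith [le_abs_self (u - b)]
  · by_contra! hb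
    have h1 := h ((b - u) / (2 * (|a| + 1))) (by have := sub_pos.2 hb; positivity)
    have h2 : (b - u) / (2 * (|a| + 1)) * a ≥ -((b - u) / 2) := by
      rw [ge_iff_le, div_mul_eq_mul_div, le_div_iff₀ (by positivity)]
      nlinarith [neg_abs_le a, sub_pos.2 hb]
    linarith

theorem eq_zero_of_forall_mul_le {a u : ℝ} (h : ∀ l : ℝ, l * a ≤ u) : a = 0 := by
  apply le_antisymm
  · exact (nonpos_and_le_of_forall_pos (b := 0) (u := u) fun ε _ => by simpa using h ε).1
  · have := (nonpos_and_le_of_forall_pos (a := -a) (b := 0) (u := u)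
      fun ε _ => by simpa using h (-ε)).1
    linarith

variable {ι : Type*} [Fintype ι] [DecidableEq ι]

/-- A real-linear functional that is nonnegative on matrices with positive definite Hermitian part
is represented by a positive semidefinite matrix. -/
theorem exists_posSemidef_of_nonneg (g : Matrix ι ι ℂ →ₗ[ℝ] ℝ)
    (hg : ∀ X : Matrix ι ι ℂ, (X + Xᴴ).PosDef → 0 ≤ g X) :
    ∃ ρ : Matrix ι ι ℂ, ρ.PosSemidef ∧ ∀ X, g X = (ρ * X).trace.re := by
  have h1 : ((1 : Matrix ι ι ℂ) + 1).PosDef := Matrix.PosDef.one.add Matrix.PosDef.one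
  -- The cone contains the whole line `1 + l • X` when `X` is skew-Hermitian, and `g` is bounded
  -- below there.
  have hskew : ∀ X : Matrix ι ι ℂ, X + Xᴴ = 0 → g X = 0 := by
    intro X hX
    have : -g X = 0 := by
      refine eq_zero_of_forall_mul_le (u := g 1) fun l => ?_
      have h2 := hg (l • X + 1) (by
        have : l • X + 1 + (l • X + 1)ᴴ = l • (X + Xᴴ) + (1 + 1) := by
          rw [Matrix.conjTranspose_add, Matrix.conjTranspose_smul, Matrix.conjTranspose_one,
            star_trivial, smul_add]
          abel
        rw [this, hX, smul_zero, zero_add]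
        exact h1)
      rw [map_add, map_smul, smul_eq_mul] at h2
      linarith
    linarith
  have hstar : ∀ X : Matrix ι ι ℂ, g Xᴴ = g X := by
    intro X
    have h2 := hskew (Xᴴ - X) (by
      rw [Matrix.conjTranspose_sub, Matrix.conjTranspose_conjTranspose]
      abel)
    rw [map_sub] at h2
    linarith
  have hpos : ∀ X : Matrix ι ι ℂ, X.PosSemidef → 0 ≤ g X := by
    intro X hX
    have h2 := (nonpos_and_le_of_forall_pos (a := -g X) (b := 0) (u := g 1) fun ε hε => ?_).1
    · linarith
    have h3 : (ε • X).PosSemidef := hX.smul hε.le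
    have h4 := hg (ε • X + 1) (by
      rw [Matrix.conjTranspose_add, Matrix.conjTranspose_one, h3.isHermitian.eq]
      exact (Matrix.PosDef.one.posSemidef_add h3).add (Matrix.PosDef.one.posSemidef_add h3))
    rw [map_add, map_smul, smul_eq_mul] at h4
    linarith
  -- `G` is the complex-linear functional with real part `g`; its values on matrix units are the
  -- entries of `ρ`.
  let G : Matrix ι ι ℂ →ₗ[ℂ] ℂ := Module.Dual.extendRCLike g
  have hG : ∀ X, G X = (g X : ℂ) - Complex.I * (g (Complex.I • X) : ℂ) := fun X => by
    simp [G, Module.Dual.extendRCLike_apply]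
  let ρ : Matrix ι ι ℂ := Matrix.of fun j i => G (Matrix.single i j 1)
  have hρ : ∀ X, (ρ * X).trace = G X := by
    intro X
    conv_rhs => rw [Matrix.matrix_eq_sum_single X]
    simp only [Matrix.trace, Matrix.diag, Matrix.mul_apply, map_sum, ρ, Matrix.of_apply]
    rw [Finset.sum_comm]
    refine Finset.sum_congr rfl fun i _ => Finset.sum_congr rfl fun j _ => ?_
    have : Matrix.single i j (X i j) = X i j • Matrix.single i j (1 : ℂ) := by
      rw [Matrix.smul_single, smul_eq_mul, mul_one]
    rw [this, map_smul, smul_eq_mul, mul_comm]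
  have hGstar : ∀ X, G Xᴴ = star (G X) := by
    intro X
    have h2 : g (Complex.I • Xᴴ) = - g (Complex.I • X) := by
      rw [← hstar (Complex.I • X), ← map_neg, Matrix.conjTranspose_smul]
      simp
    rw [hG, hG, hstar, h2]
    simp
  refine ⟨ρ, ?_, fun X => ?_⟩
  · refine Matrix.PosSemidef.of_dotProduct_mulVec_nonneg ?_ fun v => ?_
    · ext i j
      simp only [Matrix.conjTranspose_apply, ρ, Matrix.of_apply]
      rw [← hGstar, Matrix.conjTranspose_single, star_one]
    · have h2 : star v ⬝ᵥ (ρ *ᵥ v) = G (Matrix.vecMulVec v (star v)) := by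
        rw [← hρ, Matrix.mul_vecMulVec, Matrix.trace_vecMulVec, dotProduct_comm]
      have hps := Matrix.posSemidef_vecMulVec_self_star v
      have h3 : star (G (Matrix.vecMulVec v (star v))) = G (Matrix.vecMulVec v (star v)) := by
        rw [← hGstar, hps.isHermitian.eq]
      have h4 : 0 ≤ (G (Matrix.vecMulVec v (star v))).re := by
        rw [hG]
        simpa using hpos _ hps
      rw [h2, Complex.nonneg_iff]
      exact ⟨h4, (Complex.conj_eq_iff_im.1 h3).symm⟩
  · rw [hρ, hG]
    simp

variable {H M : Type*} [Fintype H] [DecidableEq H] [Fintype M] [DecidableEq M]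

/-- Minimax form of semidefinite duality: one `ρ`, with partial trace `σ` over `M`, works for all
`Q` in the convex set `S`. It comes from a hyperplane separating the open cone `D` from the convex
set `C` of pairs (constraint slack, excess of the objective over `t`). -/
theorem exists_posSemidef_of_forall_posDef {S : Set (Matrix (H × M) (H × M) ℂ)} (hS : Convex ℝ S)
    (hne : S.Nonempty) (hherm : ∀ Q ∈ S, Q.IsHermitian) {σ : Matrix H H ℂ} (hσ : σ.IsHermitian)
    {t : ℝ} (h : ∀ Q ∈ S, ∀ Z : Matrix H H ℂ, (Z ⊗ₖ (1 : Matrix M M ℂ) - Q).PosDef →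
      t ≤ (Z * σ).trace.re) :
    ∃ ρ : Matrix (H × M) (H × M) ℂ, ρ.PosSemidef ∧
      (∀ Z : Matrix H H ℂ, (ρ * (Z ⊗ₖ (1 : Matrix M M ℂ))).trace.re = (Z * σ).trace.re) ∧
      ∀ Q ∈ S, t ≤ (ρ * Q).trace.re := by
  let D : Set (Matrix (H × M) (H × M) ℂ × ℝ) := {x | (x.1 + x.1ᴴ).PosDef ∧ x.2 < 0}
  let C : Set (Matrix (H × M) (H × M) ℂ × ℝ) := {x | ∃ Q ∈ S, ∃ Z : Matrix H H ℂ,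
    x = (Z ⊗ₖ (1 : Matrix M M ℂ) - Q, (Z * σ).trace.re - t)}
  have hDo : IsOpen D := (isOpen_setOf_add_conjTranspose_posDef.preimage continuous_fst).inter
    (isOpen_Iio.preimage continuous_snd)
  have hDc : Convex ℝ D := by
    rw [convex_iff_forall_pos]
    rintro ⟨X, s⟩ ⟨hX, hs⟩ ⟨Y, s'⟩ ⟨hY, hs'⟩ a b ha hb -
    refine ⟨?_, ?_⟩
    · have := (hX.smul ha).add (hY.smul hb)
      convert this using 1
      simp only [Prod.smul_mk, Prod.mk_add_mk, Matrix.conjTranspose_add, Matrix.conjTranspose_smul,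
        star_trivial, smul_add]
      abel
    · have h1 : a * s < 0 := mul_neg_of_pos_of_neg ha hs
      have h2 : b * s' < 0 := mul_neg_of_pos_of_neg hb hs'
      show a * s + b * s' < 0
      linarith
  have hCc : Convex ℝ C := by
    rw [convex_iff_forall_pos]
    rintro _ ⟨Q, hQ, Z, rfl⟩ _ ⟨Q', hQ', Z', rfl⟩ a b ha hb hab
    refine ⟨a • Q + b • Q', hS hQ hQ' ha.le hb.le hab, a • Z + b • Z', ?_⟩
    ext1
    · simp only [Prod.smul_mk, Prod.mk_add_mk, Matrix.add_kronecker, Matrix.smul_kronecker,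
        smul_sub]
      abel
    · simp only [Prod.smul_mk, Prod.mk_add_mk, Matrix.add_mul, Matrix.smul_mul, Matrix.trace_add,
        Matrix.trace_smul, Complex.add_re, Complex.smul_re, smul_eq_mul]
      linear_combination (-t) * hab
  -- `Z` is an arbitrary matrix in `C`. Replacing it by its Hermitian part changes neither the
  -- membership in `D` nor the objective, and then `h` applies.
  have hdisj : Disjoint D C := by
    rw [Set.disjoint_left]
    rintro _ ⟨hpd, hneg⟩ ⟨Q, hQ, Z, rfl⟩
    have h1 := h Q hQ ((1 / 2 : ℝ) • (Z + Zᴴ)) (by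
      convert hpd.smul (show (0 : ℝ) < 1 / 2 by norm_num) using 1
      simp only [Matrix.conjTranspose_sub, (hherm Q hQ).eq, Matrix.conjTranspose_kronecker,
        Matrix.conjTranspose_one, Matrix.smul_kronecker, Matrix.add_kronecker]
      module)
    have h2 : (Zᴴ * σ).trace.re = (Z * σ).trace.re := by
      have h3 : (Zᴴ * σ)ᴴ = σ * Z := by
        rw [Matrix.conjTranspose_mul, Matrix.conjTranspose_conjTranspose, hσ.eq]
      rw [Matrix.trace_mul_comm Z, ← h3, Matrix.trace_conjTranspose]
      simp
    rw [Matrix.smul_mul, Matrix.add_mul, Matrix.trace_smul, Matrix.trace_add, Complex.smul_re,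
      Complex.add_re, h2, smul_eq_mul] at h1
    simp only at hneg
    linarith
  obtain ⟨f, u, hfD, hfC⟩ := geometric_hahn_banach_open hDc hDo hCc hdisj
  let f₁ : Matrix (H × M) (H × M) ℂ →ₗ[ℝ] ℝ := f.toLinearMap ∘ₗ LinearMap.inl ℝ _ ℝ
  let c : ℝ := f (0, 1)
  have hf : ∀ X s, f (X, s) = f₁ X + s * c := by
    intro X s
    have : (X, s) = (X, (0 : ℝ)) + s • ((0 : Matrix (H × M) (H × M) ℂ), (1 : ℝ)) := by simp
    rw [this, map_add, map_smul]
    rfl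
  have hD' : ∀ X : Matrix (H × M) (H × M) ℂ, (X + Xᴴ).PosDef → ∀ s < 0, f₁ X + s * c < u :=
    fun X hX s hs => hf X s ▸ hfD (X, s) ⟨hX, hs⟩
  have hC' : ∀ Q ∈ S, ∀ Z : Matrix H H ℂ, u ≤ f₁ (Z ⊗ₖ (1 : Matrix M M ℂ)) - f₁ Q +
      ((Z * σ).trace.re - t) * c := by
    intro Q hQ Z
    rw [← map_sub, ← hf]
    exact hfC _ ⟨Q, hQ, Z, rfl⟩
  have h11 : ((1 : Matrix (H × M) (H × M) ℂ) + 1ᴴ).PosDef := by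
    rw [Matrix.conjTranspose_one]
    exact Matrix.PosDef.one.add Matrix.PosDef.one
  have hscale : ∀ X : Matrix (H × M) (H × M) ℂ, (X + Xᴴ).PosDef → ∀ ε : ℝ, 0 < ε →
      (ε • X + (ε • X)ᴴ).PosDef := by
    intro X hX ε hε
    rw [Matrix.conjTranspose_smul, star_trivial, ← smul_add]
    exact hX.smul hε
  have hD0 : ∀ X : Matrix (H × M) (H × M) ℂ, (X + Xᴴ).PosDef → ∀ s < 0,
      f₁ X + s * c ≤ 0 ∧ 0 ≤ u := by
    intro X hX s hs
    refine nonpos_and_le_of_forall_pos fun ε hε => ?_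
    have h1 := hD' _ (hscale X hX ε hε) (ε * s) (mul_neg_of_pos_of_neg hε hs)
    rw [map_smul, smul_eq_mul] at h1
    linarith
  have hu : 0 ≤ u := (hD0 1 h11 (-1) (by norm_num)).2
  have hf₁ : ∀ X : Matrix (H × M) (H × M) ℂ, (X + Xᴴ).PosDef → f₁ X ≤ 0 := by
    intro X hX
    refine (nonpos_and_le_of_forall_pos (a := -c) fun ε hε => ?_).2
    have h1 := (hD0 X hX (-ε) (by linarith)).1
    linarith
  have hc0 : 0 ≤ c := by
    have := (nonpos_and_le_of_forall_pos (a := f₁ 1) (b := -c) (u := 0) fun ε hε => ?_).2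
    · linarith
    have h1 := (hD0 _ (hscale 1 h11 ε hε) (-1) (by norm_num)).1
    rw [map_smul, smul_eq_mul] at h1
    linarith
  obtain ⟨Q₀, hQ₀⟩ := hne
  -- Slater's condition: `l • 1 - Q₀` is positive definite for large `l`, which rules out a
  -- separating hyperplane with `c = 0`. Then `-f₁` can be normalized by `c`.
  have hc : 0 < c := by
    obtain ⟨l, -, hl⟩ := exists_smul_one_sub_posDef (hherm Q₀ hQ₀)
    have h1 := hC' Q₀ hQ₀ ((l : ℂ) • 1)
    have h2 := hD' ((l : ℂ) • 1 - Q₀) (by rw [hl.isHermitian.eq]; exact hl.add hl) (-1) (by norm_num)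
    rw [Matrix.smul_kronecker, Matrix.one_kronecker_one, ← map_sub] at h1
    refine lt_of_le_of_ne hc0 fun h0 => ?_
    rw [← h0] at h1 h2
    linarith
  -- A linear function of the unrestricted variable `Z` that is bounded below vanishes; this is the
  -- marginal condition on `ρ`.
  have hlin : ∀ Z : Matrix H H ℂ, f₁ (Z ⊗ₖ (1 : Matrix M M ℂ)) + (Z * σ).trace.re * c = 0 := by
    intro Z
    have : -(f₁ (Z ⊗ₖ (1 : Matrix M M ℂ)) + (Z * σ).trace.re * c) = 0 := by
      refine eq_zero_of_forall_mul_le (u := - f₁ Q₀ - t * c - u) fun l => ?_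
      have h1 := hC' Q₀ hQ₀ (l • Z)
      rw [Matrix.smul_kronecker, map_smul, Matrix.smul_mul, Matrix.trace_smul, Complex.smul_re,
        smul_eq_mul, smul_eq_mul] at h1
      linarith
    linarith
  obtain ⟨ρ, hρ, hρf⟩ := exists_posSemidef_of_nonneg ((-c⁻¹) • f₁) fun X hX => by
    have := hf₁ X hX
    have h2 : 0 < c⁻¹ := inv_pos.2 hc
    rw [LinearMap.smul_apply, smul_eq_mul]
    nlinarith
  refine ⟨ρ, hρ, fun Z => ?_, fun Q hQ => ?_⟩
  · rw [← hρf, LinearMap.smul_apply, smul_eq_mul, eq_neg_of_add_eq_zero_left (hlin Z)]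
    field_simp
  · have h1 := hC' Q hQ 0
    rw [← hρf, LinearMap.smul_apply, smul_eq_mul]
    simp only [Matrix.zero_kronecker, map_zero, Matrix.zero_mul, Matrix.trace_zero,
      Complex.zero_re] at h1
    rw [neg_mul, ← mul_neg, ← div_eq_inv_mul, le_div_iff₀ hc]
    linarith

end Duality

/-! ### Local operators on a tripartite space -/

section Tensor

variable {A M B : Type*} [Fintype A] [DecidableEq A] [Fintype M] [DecidableEq M]
  [Fintype B] [DecidableEq B]

theorem onAM_mul (X Y : Matrix (A × M) (A × M) ℂ) :
    (onAM (X * Y) : Matrix (A × M × B) (A × M × B) ℂ) = onAM X * onAM Y := by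
  simp only [onAM, Matrix.reindex_apply, Matrix.submatrix_mul_equiv, ← Matrix.mul_kronecker_mul,
    Matrix.one_mul]

theorem onMB_mul (X Y : Matrix (M × B) (M × B) ℂ) :
    (onMB (X * Y) : Matrix (A × M × B) (A × M × B) ℂ) = onMB X * onMB Y := by
  simp only [onMB, ← Matrix.mul_kronecker_mul, Matrix.one_mul]

theorem onAB_mul (X X' : Matrix A A ℂ) (Y Y' : Matrix B B ℂ) :
    (onAB (X * X') (Y * Y') : Matrix (A × M × B) (A × M × B) ℂ) = onAB X Y * onAB X' Y' := by
  simp only [onAB, ← Matrix.mul_kronecker_mul, Matrix.one_mul]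

theorem onAM_one : (onAM 1 : Matrix (A × M × B) (A × M × B) ℂ) = 1 := by
  simp [onAM]

theorem onMB_one : (onMB 1 : Matrix (A × M × B) (A × M × B) ℂ) = 1 := by
  simp [onMB]

theorem onAM_conjTranspose (X : Matrix (A × M) (A × M) ℂ) :
    (onAM X : Matrix (A × M × B) (A × M × B) ℂ)ᴴ = onAM Xᴴ := by
  simp [onAM, Matrix.conjTranspose_kronecker]

theorem onMB_conjTranspose (X : Matrix (M × B) (M × B) ℂ) :
    (onMB X : Matrix (A × M × B) (A × M × B) ℂ)ᴴ = onMB Xᴴ := by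
  simp [onMB, Matrix.conjTranspose_kronecker]

theorem onAB_conjTranspose (X : Matrix A A ℂ) (Y : Matrix B B ℂ) :
    (onAB X Y : Matrix (A × M × B) (A × M × B) ℂ)ᴴ = onAB Xᴴ Yᴴ := by
  simp [onAB, Matrix.conjTranspose_kronecker]

theorem onAM_kronecker_one (X : Matrix A A ℂ) :
    (onAM (X ⊗ₖ (1 : Matrix M M ℂ)) : Matrix (A × M × B) (A × M × B) ℂ) = onAB X 1 := by
  ext ⟨a, m, b⟩ ⟨a', m', b'⟩
  simp only [onAM, onAB, Matrix.reindex_apply, Matrix.submatrix_apply, Equiv.prodAssoc_symm_apply,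
    Matrix.kroneckerMap_apply, mul_assoc, Matrix.one_apply]

theorem onMB_one_kronecker (Y : Matrix B B ℂ) :
    (onMB ((1 : Matrix M M ℂ) ⊗ₖ Y) : Matrix (A × M × B) (A × M × B) ℂ) = onAB 1 Y := rfl

theorem onAM_mul_onAB_one (X : Matrix (A × M) (A × M) ℂ) (Y : Matrix B B ℂ) :
    (onAM X : Matrix (A × M × B) (A × M × B) ℂ) * onAB 1 Y = onAB 1 Y * onAM X := by
  have h : (onAB 1 Y : Matrix (A × M × B) (A × M × B) ℂ) =
      Matrix.reindex (Equiv.prodAssoc A M B) (Equiv.prodAssoc A M B)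
        ((1 : Matrix (A × M) (A × M) ℂ) ⊗ₖ Y) := by
    ext ⟨a, m, b⟩ ⟨a', m', b'⟩
    simp only [onAB, Matrix.reindex_apply, Matrix.submatrix_apply, Equiv.prodAssoc_symm_apply,
      Matrix.kroneckerMap_apply, Matrix.one_apply, Prod.ext_iff]
    split_ifs <;> simp_all
  simp only [h, onAM, Matrix.reindex_apply, Matrix.submatrix_mul_equiv,
    ← Matrix.mul_kronecker_mul, Matrix.one_mul, Matrix.mul_one]

theorem onMB_mul_onAB_one (X : Matrix (M × B) (M × B) ℂ) (Y : Matrix A A ℂ) :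
    (onMB X : Matrix (A × M × B) (A × M × B) ℂ) * onAB Y 1 = onAB Y 1 * onMB X := by
  simp only [onMB, onAB, Matrix.one_kronecker_one, ← Matrix.mul_kronecker_mul, Matrix.one_mul,
    Matrix.mul_one]

theorem braket_mulVec_mulVec {ι κ : Type*} [Fintype ι] [Fintype κ] (X : Matrix κ ι ℂ)
    (Z : Matrix κ κ ℂ) (v : ι → ℂ) :
    braket (X *ᵥ v) (Z *ᵥ (X *ᵥ v)) = braket v ((Xᴴ * Z * X) *ᵥ v) := by
  rw [braket, braket, star_mulVec_dotProduct, Matrix.mulVec_mulVec, Matrix.mulVec_mulVec,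
    Matrix.mul_assoc]

theorem braket_self {ι : Type*} [Fintype ι] (v : ι → ℂ) : braket v v = (sqNorm v : ℂ) := by
  simp [braket, sqNorm, dotProduct, Complex.conj_mul']

/-- `Φ * Φᴴ` is the reduced state of the bipartite vector with coefficient matrix `Φ`. -/
theorem braket_kronecker_one_mulVec {N : Type*} [Fintype N] [DecidableEq N] (Z : Matrix A A ℂ)
    (Φ : Matrix A N ℂ) :
    braket (fun x : A × N => Φ x.1 x.2) ((Z ⊗ₖ (1 : Matrix N N ℂ)) *ᵥ fun x => Φ x.1 x.2) =
      (Z * (Φ * Φᴴ)).trace := by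
  rw [← Matrix.mul_assoc, Matrix.trace_mul_comm]
  simp only [braket, dotProduct, Matrix.mulVec, Matrix.trace, Matrix.diag, Matrix.mul_apply,
    Fintype.sum_prod_type, Matrix.kroneckerMap_apply, Matrix.one_apply, Pi.star_apply,
    Matrix.conjTranspose_apply]
  rw [Finset.sum_comm]
  simp

theorem one_kronecker_mulVec {N : Type*} [Fintype N] [DecidableEq N] (W : Matrix N N ℂ)
    (Φ : Matrix A N ℂ) :
    ((1 : Matrix A A ℂ) ⊗ₖ W) *ᵥ (fun x => Φ x.1 x.2) = fun x => (Φ * Wᵀ) x.1 x.2 := by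
  ext ⟨a, n⟩
  simp only [dotProduct, Matrix.mulVec, Matrix.mul_apply,
    Fintype.sum_prod_type, Matrix.kroneckerMap_apply, Matrix.one_apply, Matrix.transpose_apply]
  simp [mul_comm]

theorem braket_onAM_mulVec (Q : Matrix (A × M) (A × M) ℂ) (R : Matrix (A × M) B ℂ) :
    braket (fun x : A × M × B => R (x.1, x.2.1) x.2.2)
      (onAM Q *ᵥ fun x => R (x.1, x.2.1) x.2.2) = (Q * (R * Rᴴ)).trace := by
  rw [← braket_kronecker_one_mulVec]
  have h : (onAM Q *ᵥ fun x : A × M × B => R (x.1, x.2.1) x.2.2) =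
      ((Q ⊗ₖ (1 : Matrix B B ℂ)) *ᵥ fun x => R x.1 x.2) ∘ (Equiv.prodAssoc A M B).symm := by
    rw [onAM, Matrix.reindex_apply, Matrix.submatrix_mulVec_equiv]
    rfl
  rw [h, braket, braket]
  exact dotProduct_comp_equiv_symm _ _ _

end Tensor

/-! ### Strong duality over all rounds -/

section Chain

variable {H M : Type*} [Fintype H] [DecidableEq H] [Fintype M] [DecidableEq M]

/-- A dual feasible sequence for the successive operators `K 0, …, K (r - 1)`, with strict
inequalities, ending at `F`. -/
def StrictChain (K : ℕ → Matrix (H × M) (H × M) ℂ) (F : Matrix H H ℂ) (r : ℕ)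
    (Z : ℕ → Matrix H H ℂ) : Prop :=
  Z r = F ∧ ∀ j < r,
    (Z j ⊗ₖ (1 : Matrix M M ℂ) - (K j)ᴴ * (Z (j + 1) ⊗ₖ (1 : Matrix M M ℂ)) * K j).PosDef

theorem posSemidef_of_kronecker_one [Nonempty M] {Z : Matrix H H ℂ}
    (h : (Z ⊗ₖ (1 : Matrix M M ℂ)).PosSemidef) : Z.PosSemidef := by
  have m := Classical.arbitrary M
  convert h.submatrix (fun x => (x, m)) using 1
  ext i j
  simp

theorem posSemidef_conj_kronecker_one (K : Matrix (H × M) (H × M) ℂ) {Z : Matrix H H ℂ}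
    (hZ : Z.PosSemidef) : (Kᴴ * (Z ⊗ₖ (1 : Matrix M M ℂ)) * K).PosSemidef :=
  (hZ.kronecker Matrix.PosSemidef.one).conjTranspose_mul_mul_same K

theorem StrictChain.posSemidef [Nonempty M] {K : ℕ → Matrix (H × M) (H × M) ℂ} {F : Matrix H H ℂ}
    (hF : F.PosSemidef) {r : ℕ} {Z : ℕ → Matrix H H ℂ} (hZ : StrictChain K F r Z) {j : ℕ}
    (hj : j ≤ r) : (Z j).PosSemidef := by
  induction hj using Nat.decreasingInduction with
  | self => rw [hZ.1]; exact hF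
  | of_succ j hj ih =>
    apply posSemidef_of_kronecker_one (M := M)
    have h := (hZ.2 j hj).posSemidef.add (posSemidef_conj_kronecker_one (K j) ih)
    rwa [sub_add_cancel] at h

theorem StrictChain.cons {K : ℕ → Matrix (H × M) (H × M) ℂ} {F : Matrix H H ℂ} {r : ℕ}
    {Z : ℕ → Matrix H H ℂ} (hZ : StrictChain (fun j => K (j + 1)) F r Z) {Z' : Matrix H H ℂ}
    (h : (Z' ⊗ₖ (1 : Matrix M M ℂ) - (K 0)ᴴ * (Z 0 ⊗ₖ (1 : Matrix M M ℂ)) * K 0).PosDef) :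
    StrictChain K F (r + 1) (fun j => Nat.casesOn j Z' Z) := by
  refine ⟨hZ.1, fun j hj => ?_⟩
  cases j with
  | zero => exact h
  | succ j => exact hZ.2 j (by omega)

/-- Going backwards from `F`, a large multiple of the identity strictly dominates each constraint.
This makes the set of dual continuations nonempty. -/
theorem exists_strictChain [Nonempty M] (K : ℕ → Matrix (H × M) (H × M) ℂ) {F : Matrix H H ℂ}
    (hF : F.PosSemidef) (r : ℕ) : ∃ Z, StrictChain K F r Z := by
  induction r generalizing K with
  | zero => exact ⟨fun _ => F, rfl, by simp⟩
  | succ r ih =>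
    obtain ⟨Z, hZ⟩ := ih fun j => K (j + 1)
    obtain ⟨c, -, hc⟩ := exists_smul_one_sub_posDef
      (posSemidef_conj_kronecker_one (K 0) (hZ.posSemidef hF (Nat.zero_le r))).isHermitian
    refine ⟨_, hZ.cons (Z' := (c : ℂ) • 1) ?_⟩
    rwa [Matrix.smul_kronecker, Matrix.one_kronecker_one]

theorem convex_setOf_strictChain (K : ℕ → Matrix (H × M) (H × M) ℂ) (F : Matrix H H ℂ) (r : ℕ) :
    Convex ℝ {Z₀ | ∃ Z, StrictChain K F r Z ∧ Z 0 = Z₀} := by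
  rw [convex_iff_forall_pos]
  rintro _ ⟨Z, hZ, rfl⟩ _ ⟨Z', hZ', rfl⟩ a b ha hb hab
  refine ⟨fun j => a • Z j + b • Z' j, ⟨?_, fun j hj => ?_⟩, rfl⟩
  · show a • Z r + b • Z' r = F
    rw [hZ.1, hZ'.1, ← add_smul, hab, one_smul]
  · convert ((hZ.2 j hj).smul ha).add ((hZ'.2 j hj).smul hb) using 1
    simp only [Matrix.add_kronecker, Matrix.smul_kronecker, Matrix.mul_add, Matrix.add_mul,
      Matrix.mul_smul, Matrix.smul_mul, smul_sub]
    abel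

theorem transpose_mem_unitaryGroup {W : Matrix H H ℂ} (hW : W ∈ Matrix.unitaryGroup H ℂ) :
    Wᵀ ∈ Matrix.unitaryGroup H ℂ := by
  rw [Matrix.mem_unitaryGroup_iff'] at hW
  have h := congrArg Matrix.transpose hW
  rw [Matrix.transpose_mul, Matrix.transpose_one] at h
  exact Matrix.mem_unitaryGroup_iff.2 h

/-- The best response of the adversary in one round, against a convex set of dual variables. -/
theorem exists_unitary_forall_le (K : Matrix (H × M) (H × M) ℂ) {S : Set (Matrix H H ℂ)}
    (hS : Convex ℝ S) (hne : S.Nonempty) (hherm : ∀ Z ∈ S, Z.IsHermitian)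
    (φ : H × M × Fin (Fintype.card (H × M)) → ℂ) {t : ℝ}
    (h : ∀ Z ∈ S, ∀ Z' : Matrix H H ℂ,
      (Z' ⊗ₖ (1 : Matrix M M ℂ) - Kᴴ * (Z ⊗ₖ (1 : Matrix M M ℂ)) * K).PosDef →
      t ≤ (braket φ (onAB Z' 1 *ᵥ φ)).re) :
    ∃ W ∈ Matrix.unitaryGroup (M × Fin (Fintype.card (H × M))) ℂ, ∀ Z ∈ S,
      t ≤ (braket (onAM K *ᵥ (onMB W *ᵥ φ)) (onAB Z 1 *ᵥ (onAM K *ᵥ (onMB W *ᵥ φ)))).re := by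
  -- The vector `φ` as a coefficient matrix between the honest workspace and the adversary's system;
  -- `Φ * Φᴴ` is the marginal that the adversary cannot change.
  let Φ : Matrix H (M × Fin (Fintype.card (H × M))) ℂ := Matrix.of fun a n => φ (a, n)
  have hΦ : ∀ Z : Matrix H H ℂ, braket φ (onAB Z 1 *ᵥ φ) = (Z * (Φ * Φᴴ)).trace := fun Z => by
    rw [← braket_kronecker_one_mulVec, onAB, Matrix.one_kronecker_one]
    rfl
  let T : Set (Matrix (H × M) (H × M) ℂ) :=
    (fun Z => Kᴴ * (Z ⊗ₖ (1 : Matrix M M ℂ)) * K) '' S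
  have hT : Convex ℝ T := by
    rw [convex_iff_forall_pos]
    rintro _ ⟨Z, hZ, rfl⟩ _ ⟨Z', hZ', rfl⟩ a b ha hb hab
    refine ⟨a • Z + b • Z', hS hZ hZ' ha.le hb.le hab, ?_⟩
    simp only [Matrix.add_kronecker, Matrix.smul_kronecker, Matrix.mul_add, Matrix.add_mul,
      Matrix.mul_smul, Matrix.smul_mul]
  obtain ⟨ρ, hρ, hρσ, hρT⟩ := exists_posSemidef_of_forall_posDef hT (hne.image _)
    (σ := Φ * Φᴴ) (t := t) (by
      rintro _ ⟨Z, hZ, rfl⟩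
      refine Matrix.isHermitian_conjTranspose_mul_mul _ ?_
      rw [Matrix.IsHermitian, Matrix.conjTranspose_kronecker, (hherm Z hZ).eq,
        Matrix.conjTranspose_one])
    (Matrix.posSemidef_self_mul_conjTranspose Φ).isHermitian (by
      rintro _ ⟨Z, hZ, rfl⟩ Z' hZ'
      rw [← hΦ]
      exact h Z hZ Z' hZ')
  obtain ⟨R₀, hR₀⟩ : ∃ R₀ : Matrix (H × M) (H × M) ℂ, ρ = R₀ * R₀ᴴ := by
    open scoped MatrixOrder in
    obtain ⟨R, hR⟩ := CStarAlgebra.nonneg_iff_eq_mul_star_self.mp hρ.nonneg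
    exact ⟨R, hR⟩
  -- A square root of `ρ` with columns indexed by the workspace is a purification of `ρ`; hence
  -- workspace dimension `card (H × M)` suffices.
  let R : Matrix (H × M) (Fin (Fintype.card (H × M))) ℂ :=
    R₀.submatrix id (Fintype.equivFin (H × M)).symm
  have hR : ρ = R * Rᴴ := by
    rw [hR₀, Matrix.conjTranspose_submatrix, Matrix.submatrix_mul_equiv, Matrix.submatrix_id_id]
  let Χ : Matrix H (M × Fin (Fintype.card (H × M))) ℂ := Matrix.of fun a n => R (a, n.1) n.2
  let χ : H × M × Fin (Fintype.card (H × M)) → ℂ := fun x => Χ x.1 x.2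
  have hχ : ∀ Q, braket χ (onAM Q *ᵥ χ) = (ρ * Q).trace := fun Q => by
    rw [Matrix.trace_mul_comm, hR, ← braket_onAM_mulVec]
    rfl
  have hΧ : Φ * Φᴴ = Χ * Χᴴ := by
    have h1 : ∀ Z : Matrix H H ℂ, (Z * (Φ * Φᴴ - Χ * Χᴴ)).trace.re = 0 := by
      intro Z
      rw [Matrix.mul_sub, Matrix.trace_sub, Complex.sub_re, ← hρσ, ← hχ, onAM_kronecker_one, onAB,
        Matrix.one_kronecker_one, braket_kronecker_one_mulVec, sub_self]
    -- Testing against the adjoint of the difference gives its squared Hilbert–Schmidt norm.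
    have h2 := h1 (Φ * Φᴴ - Χ * Χᴴ)ᴴ
    have h3 := (Complex.nonneg_iff.1 (Matrix.posSemidef_conjTranspose_mul_self
      (Φ * Φᴴ - Χ * Χᴴ)).trace_nonneg).2
    exact sub_eq_zero.1 (Matrix.trace_conjTranspose_mul_self_eq_zero_iff.1
      (Complex.ext h2 h3.symm))
  obtain ⟨W, hW, hΧW⟩ := exists_unitary_mul_eq hΧ
  refine ⟨Wᵀ, transpose_mem_unitaryGroup hW, fun Z hZ => ?_⟩
  have hφχ : onMB Wᵀ *ᵥ φ = χ := by
    have h1 := one_kronecker_mulVec Wᵀ Φ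
    rw [Matrix.transpose_transpose, ← hΧW] at h1
    exact h1
  rw [hφχ, braket_mulVec_mulVec, ← onAM_kronecker_one, onAM_conjTranspose, ← onAM_mul, ← onAM_mul,
    hχ]
  exact hρT _ ⟨Z, hZ, rfl⟩

/-- The state after `j` rounds in which the adversary applies `W j` and then the honest player
applies `K j`. -/
noncomputable def chainRun {d : ℕ} (K : ℕ → Matrix (H × M) (H × M) ℂ)
    (W : ℕ → Matrix (M × Fin d) (M × Fin d) ℂ) (φ : H × M × Fin d → ℂ) :
    ℕ → (H × M × Fin d → ℂ)
  | 0 => φ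
  | j + 1 => onAM (K j) *ᵥ (onMB (W j) *ᵥ chainRun K W φ j)

theorem chainRun_succ' {d : ℕ} (K : ℕ → Matrix (H × M) (H × M) ℂ)
    (W : ℕ → Matrix (M × Fin d) (M × Fin d) ℂ) (φ : H × M × Fin d → ℂ) (j : ℕ) :
    chainRun K W φ (j + 1) = chainRun (fun j => K (j + 1)) (fun j => W (j + 1))
      (onAM (K 0) *ᵥ (onMB (W 0) *ᵥ φ)) j := by
  induction j with
  | zero => rfl
  | succ j ih => rw [chainRun, ih]; rfl

/-- Strong duality: an adversary with a large enough workspace attains every lower bound on the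
dual value. -/
theorem exists_unitary_le_chainRun [Nonempty M] {F : Matrix H H ℂ} (hF : F.PosSemidef) {t : ℝ}
    (r : ℕ) (K : ℕ → Matrix (H × M) (H × M) ℂ) (φ : H × M × Fin (Fintype.card (H × M)) → ℂ)
    (h : ∀ Z, StrictChain K F r Z → t ≤ (braket φ (onAB (Z 0) 1 *ᵥ φ)).re) :
    ∃ W : ℕ → Matrix (M × Fin (Fintype.card (H × M))) (M × Fin (Fintype.card (H × M))) ℂ,
      (∀ j, W j ∈ Matrix.unitaryGroup (M × Fin (Fintype.card (H × M))) ℂ) ∧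
      t ≤ (braket (chainRun K W φ r) (onAB F 1 *ᵥ chainRun K W φ r)).re := by
  induction r generalizing K φ with
  | zero => exact ⟨fun _ => 1, fun _ => one_mem _, h (fun _ => F) ⟨rfl, by simp⟩⟩
  | succ r ih =>
    obtain ⟨Z₁, hZ₁⟩ := exists_strictChain (fun j => K (j + 1)) hF r
    have hherm : ∀ Z₀ ∈ {Z₀ | ∃ Z, StrictChain (fun j => K (j + 1)) F r Z ∧ Z 0 = Z₀},
        Z₀.IsHermitian := by
      rintro _ ⟨Z, hZ, rfl⟩
      exact (hZ.posSemidef hF (Nat.zero_le r)).isHermitian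
    have hcons : ∀ Z₀ ∈ {Z₀ | ∃ Z, StrictChain (fun j => K (j + 1)) F r Z ∧ Z 0 = Z₀},
        ∀ Z' : Matrix H H ℂ,
        (Z' ⊗ₖ (1 : Matrix M M ℂ) - (K 0)ᴴ * (Z₀ ⊗ₖ (1 : Matrix M M ℂ)) * K 0).PosDef →
        t ≤ (braket φ (onAB Z' 1 *ᵥ φ)).re := by
      rintro _ ⟨Z, hZ, rfl⟩ Z' hZ'
      have h1 := h _ (hZ.cons hZ')
      exact h1
    -- The first move `W₀` is good against every dual sequence of the remaining rounds, which is
    -- exactly the hypothesis of the induction for the state after this round.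
    obtain ⟨W₀, hW₀, h₀⟩ := exists_unitary_forall_le (K 0)
      (convex_setOf_strictChain (fun j => K (j + 1)) F r)
      ⟨Z₁ 0, Z₁, hZ₁, rfl⟩
      hherm φ (t := t) hcons
    obtain ⟨W, hW, hle⟩ := ih (fun j => K (j + 1)) (onAM (K 0) *ᵥ (onMB W₀ *ᵥ φ))
      fun Z hZ => h₀ _ ⟨Z, hZ, rfl⟩
    refine ⟨fun j => Nat.casesOn j W₀ W, fun j => ?_, ?_⟩
    · cases j with
      | zero => exact hW₀
      | succ j => exact hW j
    · rw [chainRun_succ']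
      exact hle

end Chain

/-! ### Product vectors and norm estimates -/

section Vectors

theorem kronecker_mulVec_tensorVec {ι κ : Type*} [Fintype ι] [Fintype κ] (X : Matrix ι ι ℂ)
    (Y : Matrix κ κ ℂ) (v : ι → ℂ) (w : κ → ℂ) :
    (X ⊗ₖ Y) *ᵥ tensorVec v w = tensorVec (X *ᵥ v) (Y *ᵥ w) := by
  ext ⟨i, j⟩
  simp only [Matrix.mulVec, dotProduct, tensorVec, Matrix.kroneckerMap_apply,
    Fintype.sum_prod_type, Finset.sum_mul_sum]
  exact Finset.sum_congr rfl fun _ _ => Finset.sum_congr rfl fun _ _ => by ring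

theorem braket_tensorVec {ι κ : Type*} [Fintype ι] [Fintype κ] (v v' : ι → ℂ) (w w' : κ → ℂ) :
    braket (tensorVec v w) (tensorVec v' w') = braket v v' * braket w w' := by
  simp only [braket, dotProduct, tensorVec, Fintype.sum_prod_type, Finset.sum_mul_sum,
    Pi.star_apply, star_mul']
  exact Finset.sum_congr rfl fun _ _ => Finset.sum_congr rfl fun _ _ => by ring

theorem sqNorm_tensorVec {ι κ : Type*} [Fintype ι] [Fintype κ] (v : ι → ℂ) (w : κ → ℂ) :
    sqNorm (tensorVec v w) = sqNorm v * sqNorm w := by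
  have h := braket_tensorVec v v w w
  simp only [braket_self] at h
  exact_mod_cast h

theorem sqNorm_eq_re_braket {ι : Type*} [Fintype ι] (v : ι → ℂ) :
    sqNorm v = (braket v v).re := by
  rw [braket_self, Complex.ofReal_re]

theorem sqNorm_mulVec_le {ι : Type*} [Fintype ι] [DecidableEq ι] {X : Matrix ι ι ℂ}
    (hX : (1 - Xᴴ * X).PosSemidef) (v : ι → ℂ) : sqNorm (X *ᵥ v) ≤ sqNorm v := by
  have h := hX.re_dotProduct_nonneg v
  rw [Matrix.sub_mulVec, dotProduct_sub, Matrix.one_mulVec, ← Matrix.mulVec_mulVec,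
    ← star_mulVec_dotProduct] at h
  rw [sqNorm_eq_re_braket, sqNorm_eq_re_braket]
  simpa [braket] using h

theorem sqNorm_unitary_mulVec {ι : Type*} [Fintype ι] [DecidableEq ι] {W : Matrix ι ι ℂ}
    (hW : W ∈ Matrix.unitaryGroup ι ℂ) (v : ι → ℂ) : sqNorm (W *ᵥ v) = sqNorm v := by
  have h : Wᴴ * W = 1 := Matrix.mem_unitaryGroup_iff'.1 hW
  rw [sqNorm_eq_re_braket, sqNorm_eq_re_braket, braket, star_mulVec_dotProduct,
    Matrix.mulVec_mulVec, h, Matrix.one_mulVec, braket]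

theorem re_braket_le_sqNorm {ι : Type*} [Fintype ι] [DecidableEq ι] {X : Matrix ι ι ℂ}
    (hX : (1 - X).PosSemidef) (v : ι → ℂ) : (braket v (X *ᵥ v)).re ≤ sqNorm v := by
  have h := hX.re_dotProduct_nonneg v
  rw [Matrix.sub_mulVec, dotProduct_sub, Matrix.one_mulVec] at h
  rw [sqNorm_eq_re_braket]
  simpa [braket] using h

theorem sqNorm_single {ι : Type*} [Fintype ι] [DecidableEq ι] (k : ι) :
    sqNorm (Pi.single k 1 : ι → ℂ) = 1 := by
  rw [sqNorm, Finset.sum_eq_single k]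
  · simp
  · intro b _ hb
    simp [hb]
  · simp

theorem sqNorm_zero {ι : Type*} [Fintype ι] : sqNorm (0 : ι → ℂ) = 0 := by
  simp [sqNorm]

theorem nonempty_of_sqNorm_eq_one {ι : Type*} [Fintype ι] {v : ι → ℂ} (h : sqNorm v = 1) :
    Nonempty ι := by
  by_contra hι
  rw [not_nonempty_iff] at hι
  simp [sqNorm] at h

variable {A M B : Type*} [Fintype A] [DecidableEq A] [Fintype M] [DecidableEq M]
  [Fintype B] [DecidableEq B]

theorem onAB_mulVec_tensorVec (X : Matrix A A ℂ) (Y : Matrix B B ℂ) (a : A → ℂ) (m : M → ℂ)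
    (b : B → ℂ) : onAB X Y *ᵥ tensorVec a (tensorVec m b) =
      tensorVec (X *ᵥ a) (tensorVec m (Y *ᵥ b)) := by
  rw [onAB, kronecker_mulVec_tensorVec, kronecker_mulVec_tensorVec, Matrix.one_mulVec]

theorem onMB_mulVec_tensorVec (W : Matrix (M × B) (M × B) ℂ) (a : A → ℂ) (ω : M × B → ℂ) :
    onMB W *ᵥ tensorVec a ω = tensorVec a (W *ᵥ ω) := by
  rw [onMB, kronecker_mulVec_tensorVec, Matrix.one_mulVec]

theorem onAM_mulVec_assoc (X : Matrix (A × M) (A × M) ℂ) (v : A × M → ℂ) (b : B → ℂ) :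
    onAM X *ᵥ (fun x : A × M × B => v (x.1, x.2.1) * b x.2.2) =
      fun x => (X *ᵥ v) (x.1, x.2.1) * b x.2.2 := by
  have h := kronecker_mulVec_tensorVec X (1 : Matrix B B ℂ) v b
  rw [Matrix.one_mulVec] at h
  rw [onAM, Matrix.reindex_apply, Matrix.submatrix_mulVec_equiv]
  exact congrArg (fun u => u ∘ (Equiv.prodAssoc A M B).symm) h

theorem onAB_posSemidef {X : Matrix A A ℂ} {Y : Matrix B B ℂ} (hX : X.PosSemidef)
    (hY : Y.PosSemidef) : (onAB X Y : Matrix (A × M × B) (A × M × B) ℂ).PosSemidef :=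
  hX.kronecker (Matrix.PosSemidef.one.kronecker hY)

theorem onAM_posDef {X : Matrix (A × M) (A × M) ℂ} (hX : X.PosDef) :
    (onAM X : Matrix (A × M × B) (A × M × B) ℂ).PosDef :=
  (hX.kronecker Matrix.PosDef.one).submatrix (Equiv.injective _)

theorem onMB_posDef {X : Matrix (M × B) (M × B) ℂ} (hX : X.PosDef) :
    (onMB X : Matrix (A × M × B) (A × M × B) ℂ).PosDef :=
  Matrix.PosDef.one.kronecker hX

theorem onAM_sub (X Y : Matrix (A × M) (A × M) ℂ) :
    (onAM (X - Y) : Matrix (A × M × B) (A × M × B) ℂ) = onAM X - onAM Y := by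
  ext; simp [onAM, sub_mul]

theorem onMB_sub (X Y : Matrix (M × B) (M × B) ℂ) :
    (onMB (X - Y) : Matrix (A × M × B) (A × M × B) ℂ) = onMB X - onMB Y := by
  ext; simp [onMB, mul_sub]

theorem onAM_mem_unitaryGroup {U : Matrix (A × M) (A × M) ℂ}
    (hU : U ∈ Matrix.unitaryGroup (A × M) ℂ) :
    (onAM U : Matrix (A × M × B) (A × M × B) ℂ) ∈ Matrix.unitaryGroup (A × M × B) ℂ := by
  rw [Matrix.mem_unitaryGroup_iff, Matrix.star_eq_conjTranspose, onAM_conjTranspose, ← onAM_mul,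
    ← Matrix.star_eq_conjTranspose, Matrix.mem_unitaryGroup_iff.1 hU, onAM_one]

theorem onMB_mem_unitaryGroup {U : Matrix (M × B) (M × B) ℂ}
    (hU : U ∈ Matrix.unitaryGroup (M × B) ℂ) :
    (onMB U : Matrix (A × M × B) (A × M × B) ℂ) ∈ Matrix.unitaryGroup (A × M × B) ℂ := by
  rw [Matrix.mem_unitaryGroup_iff, Matrix.star_eq_conjTranspose, onMB_conjTranspose, ← onMB_mul,
    ← Matrix.star_eq_conjTranspose, Matrix.mem_unitaryGroup_iff.1 hU, onMB_one]

theorem isStarProjection_onAM {E : Matrix (A × M) (A × M) ℂ} (hE : IsStarProjection E) :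
    IsStarProjection (onAM E : Matrix (A × M × B) (A × M × B) ℂ) := by
  refine ⟨?_, ?_⟩
  · rw [IsIdempotentElem, ← onAM_mul, hE.isIdempotentElem.eq]
  · rw [IsSelfAdjoint, Matrix.star_eq_conjTranspose, onAM_conjTranspose,
      ← Matrix.star_eq_conjTranspose, hE.isSelfAdjoint.star_eq]

theorem isStarProjection_onMB {E : Matrix (M × B) (M × B) ℂ} (hE : IsStarProjection E) :
    IsStarProjection (onMB E : Matrix (A × M × B) (A × M × B) ℂ) := by
  refine ⟨?_, ?_⟩
  · rw [IsIdempotentElem, ← onMB_mul, hE.isIdempotentElem.eq]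
  · rw [IsSelfAdjoint, Matrix.star_eq_conjTranspose, onMB_conjTranspose,
      ← Matrix.star_eq_conjTranspose, hE.isSelfAdjoint.star_eq]

theorem posSemidef_one_sub_of_isStarProjection {ι : Type*} [Fintype ι] [DecidableEq ι]
    {E : Matrix ι ι ℂ} (hE : IsStarProjection E) : (1 - E).PosSemidef := by
  have h := Matrix.posSemidef_conjTranspose_mul_self (1 - E)
  have h1 := hE.one_sub
  rwa [← Matrix.star_eq_conjTranspose, h1.isSelfAdjoint.star_eq, h1.isIdempotentElem.eq] at h

theorem posSemidef_one_sub_conjTranspose_mul_self {ι : Type*} [Fintype ι] [DecidableEq ι]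
    {E U : Matrix ι ι ℂ} (hE : IsStarProjection E) (hU : U ∈ Matrix.unitaryGroup ι ℂ) :
    (1 - (E * U)ᴴ * (E * U)).PosSemidef := by
  convert (posSemidef_one_sub_of_isStarProjection hE).conjTranspose_mul_mul_same U using 1
  have h1 : Uᴴ * U = 1 := Matrix.mem_unitaryGroup_iff'.1 hU
  have h2 : Eᴴ = E := hE.isSelfAdjoint
  have h3 : E * E = E := hE.isIdempotentElem
  rw [Matrix.conjTranspose_mul, h2, Matrix.mul_sub, Matrix.sub_mul, Matrix.mul_one, h1,
    Matrix.mul_assoc, ← Matrix.mul_assoc E, h3, Matrix.mul_assoc]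

theorem sqNorm_onAM_mulVec_le {E U : Matrix (A × M) (A × M) ℂ} (hE : IsStarProjection E)
    (hU : U ∈ Matrix.unitaryGroup (A × M) ℂ) (v : A × M × B → ℂ) :
    sqNorm (onAM (E * U) *ᵥ v) ≤ sqNorm v := by
  refine sqNorm_mulVec_le ?_ v
  rw [onAM_mul]
  exact posSemidef_one_sub_conjTranspose_mul_self (isStarProjection_onAM hE)
    (onAM_mem_unitaryGroup hU)

theorem sqNorm_onMB_mulVec_le {E U : Matrix (M × B) (M × B) ℂ} (hE : IsStarProjection E)
    (hU : U ∈ Matrix.unitaryGroup (M × B) ℂ) (v : A × M × B → ℂ) :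
    sqNorm (onMB (E * U) *ᵥ v) ≤ sqNorm v := by
  refine sqNorm_mulVec_le ?_ v
  rw [onMB_mul]
  exact posSemidef_one_sub_conjTranspose_mul_self (isStarProjection_onMB hE)
    (onMB_mem_unitaryGroup hU)

end Vectors

/-! ### Cheating strategies and the dual sequences that bound them -/

section Cheating

variable {A M B : Type*} [Fintype A] [DecidableEq A] [Fintype M] [DecidableEq M]
  [Fintype B] [DecidableEq B]

theorem onAB_add_left (X X' : Matrix A A ℂ) (Y : Matrix B B ℂ) :
    (onAB (X + X') Y : Matrix (A × M × B) (A × M × B) ℂ) = onAB X Y + onAB X' Y :=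
  Matrix.add_kronecker _ _ _

theorem onAB_add_right (X : Matrix A A ℂ) (Y Y' : Matrix B B ℂ) :
    (onAB X (Y + Y') : Matrix (A × M × B) (A × M × B) ℂ) = onAB X Y + onAB X Y' := by
  rw [onAB, Matrix.kronecker_add, Matrix.kronecker_add]; rfl

theorem onAB_one_one : (onAB 1 1 : Matrix (A × M × B) (A × M × B) ℂ) = 1 := by
  rw [onAB, Matrix.one_kronecker_one, Matrix.one_kronecker_one]

namespace Protocol

theorem IsWCF.sqNorm_runB_le {P : Protocol A M B} (hP : P.IsWCF) {d : ℕ} {ω : M × Fin d → ℂ}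
    (hω : sqNorm ω = 1) {V : ℕ → Matrix (M × Fin d) (M × Fin d) ℂ}
    (hV : ∀ i, V i ∈ Matrix.unitaryGroup (M × Fin d) ℂ) {i : ℕ} (hi : i ≤ P.n) :
    sqNorm (P.runB ω V i) ≤ 1 := by
  induction i with
  | zero => rw [runB, sqNorm_tensorVec, hP.unit_ψA, hω, one_mul]
  | succ i ih =>
    refine le_trans ?_ (ih (by omega))
    rw [runB]
    split_ifs with h
    · exact sqNorm_onAM_mulVec_le (hP.proj_EA _ h hi) (hP.unitary_UA _ h hi) _
    · exact (sqNorm_unitary_mulVec (onMB_mem_unitaryGroup (hV _)) _).le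

theorem IsWCF.sqNorm_runA_le {P : Protocol A M B} (hP : P.IsWCF) {d : ℕ} {ω : Fin d × M → ℂ}
    (hω : sqNorm ω = 1) {V : ℕ → Matrix (Fin d × M) (Fin d × M) ℂ}
    (hV : ∀ i, V i ∈ Matrix.unitaryGroup (Fin d × M) ℂ) {i : ℕ} (hi : i ≤ P.n) :
    sqNorm (P.runA ω V i) ≤ 1 := by
  induction i with
  | zero =>
    have h : sqNorm (P.runA ω V 0) = sqNorm (tensorVec ω P.ψB) :=
      Fintype.sum_equiv (Equiv.prodAssoc (Fin d) M B).symm _ _ fun x => rfl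
    rw [h, sqNorm_tensorVec, hP.unit_ψB, hω, one_mul]
  | succ i ih =>
    refine le_trans ?_ (ih (by omega))
    rw [runA]
    split_ifs with h
    · exact (sqNorm_unitary_mulVec (onAM_mem_unitaryGroup (hV _)) _).le
    · rw [Nat.not_odd_iff_even] at h
      exact sqNorm_onMB_mulVec_le (hP.proj_EB _ h (by omega) hi) (hP.unitary_UB _ h (by omega) hi) _

theorem IsWCF.winB_nonneg {P : Protocol A M B} (hP : P.IsWCF) {d : ℕ} (ω : M × Fin d → ℂ)
    (V : ℕ → Matrix (M × Fin d) (M × Fin d) ℂ) : 0 ≤ P.winB ω V :=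
  (onAB_posSemidef hP.posSemidef_FA1 Matrix.PosSemidef.one).re_dotProduct_nonneg _

theorem IsWCF.winA_nonneg {P : Protocol A M B} (hP : P.IsWCF) {d : ℕ} (ω : Fin d × M → ℂ)
    (V : ℕ → Matrix (Fin d × M) (Fin d × M) ℂ) : 0 ≤ P.winA ω V :=
  (onAB_posSemidef Matrix.PosSemidef.one hP.posSemidef_FB0).re_dotProduct_nonneg _

theorem IsWCF.winB_le_one {P : Protocol A M B} (hP : P.IsWCF) {d : ℕ} {ω : M × Fin d → ℂ}
    (hω : sqNorm ω = 1) {V : ℕ → Matrix (M × Fin d) (M × Fin d) ℂ}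
    (hV : ∀ i, V i ∈ Matrix.unitaryGroup (M × Fin d) ℂ) : P.winB ω V ≤ 1 := by
  refine le_trans (re_braket_le_sqNorm ?_ _) (hP.sqNorm_runB_le hω hV le_rfl)
  convert onAB_posSemidef (M := M) hP.posSemidef_FA0 (Matrix.PosSemidef.one (n := Fin d) (R := ℂ))
    using 1
  rw [sub_eq_iff_eq_add, ← onAB_add_left, hP.sum_FA, onAB_one_one]

theorem IsWCF.winA_le_one {P : Protocol A M B} (hP : P.IsWCF) {d : ℕ} {ω : Fin d × M → ℂ}
    (hω : sqNorm ω = 1) {V : ℕ → Matrix (Fin d × M) (Fin d × M) ℂ}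
    (hV : ∀ i, V i ∈ Matrix.unitaryGroup (Fin d × M) ℂ) : P.winA ω V ≤ 1 := by
  refine le_trans (re_braket_le_sqNorm ?_ _) (hP.sqNorm_runA_le hω hV le_rfl)
  convert onAB_posSemidef (M := M) (Matrix.PosSemidef.one (n := Fin d) (R := ℂ)) hP.posSemidef_FB1
    using 1
  rw [sub_eq_iff_eq_add, ← onAB_add_right, add_comm, hP.sum_FB, onAB_one_one]

/-- The uniform bound 1 makes the set of winning probabilities bounded above, without which the real
`sSup` would not dominate its members. -/
theorem IsWCF.winB_le_optB {P : Protocol A M B} (hP : P.IsWCF) {d : ℕ} {χ : Fin d → ℂ}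
    (hχ : sqNorm χ = 1) {V : ℕ → Matrix (M × Fin d) (M × Fin d) ℂ}
    (hV : ∀ i, V i ∈ Matrix.unitaryGroup (M × Fin d) ℂ) :
    P.winB (tensorVec P.ψM χ) V ≤ P.optB := by
  refine le_csSup ⟨1, ?_⟩ ⟨d, χ, V, hχ, hV, rfl⟩
  rintro _ ⟨d, χ, V, hχ, hV, rfl⟩
  exact hP.winB_le_one (by rw [sqNorm_tensorVec, hP.unit_ψM, hχ, one_mul]) hV

theorem IsWCF.winB_le_optBEarly {P : Protocol A M B} (hP : P.IsWCF) {d : ℕ} {ω : M × Fin d → ℂ}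
    (hω : sqNorm ω = 1) {V : ℕ → Matrix (M × Fin d) (M × Fin d) ℂ}
    (hV : ∀ i, V i ∈ Matrix.unitaryGroup (M × Fin d) ℂ) : P.winB ω V ≤ P.optBEarly := by
  refine le_csSup ⟨1, ?_⟩ ⟨d, ω, V, hω, hV, rfl⟩
  rintro _ ⟨d, ω, V, hω, hV, rfl⟩
  exact hP.winB_le_one hω hV

theorem IsWCF.winA_le_optA {P : Protocol A M B} (hP : P.IsWCF) {d : ℕ} {ω : Fin d × M → ℂ}
    (hω : sqNorm ω = 1) {V : ℕ → Matrix (Fin d × M) (Fin d × M) ℂ}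
    (hV : ∀ i, V i ∈ Matrix.unitaryGroup (Fin d × M) ℂ) : P.winA ω V ≤ P.optA := by
  refine le_csSup ⟨1, ?_⟩ ⟨d, ω, V, hω, hV, rfl⟩
  rintro _ ⟨d, ω, V, hω, hV, rfl⟩
  exact hP.winA_le_one hω hV

theorem IsWCF.optB_nonneg {P : Protocol A M B} (hP : P.IsWCF) : 0 ≤ P.optB :=
  Real.sSup_nonneg (by rintro _ ⟨d, χ, V, -, -, rfl⟩; exact hP.winB_nonneg _ _)

theorem IsWCF.optBEarly_nonneg {P : Protocol A M B} (hP : P.IsWCF) : 0 ≤ P.optBEarly :=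
  Real.sSup_nonneg (by rintro _ ⟨d, χ, V, -, -, rfl⟩; exact hP.winB_nonneg _ _)

theorem IsWCF.optA_nonneg {P : Protocol A M B} (hP : P.IsWCF) : 0 ≤ P.optA :=
  Real.sSup_nonneg (by rintro _ ⟨d, χ, V, -, -, rfl⟩; exact hP.winA_nonneg _ _)

end Protocol

/-! ### Exchanging the roles of the two players -/

section Swap

/-- Reversal of the three tensor factors. -/
def reverse (A M B : Type*) : B × M × A ≃ A × M × B where
  toFun x := (x.2.2, x.2.1, x.1)
  invFun x := (x.2.2, x.2.1, x.1)

theorem onMB_mulVec_comp_reverse (X : Matrix (M × B) (M × B) ℂ) (v : A × M × B → ℂ) :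
    (onMB X *ᵥ v) ∘ reverse A M B =
      onAM (X.submatrix Prod.swap Prod.swap) *ᵥ (v ∘ reverse A M B) := by
  have h : (onAM (X.submatrix Prod.swap Prod.swap) : Matrix (B × M × A) (B × M × A) ℂ) =
      (onMB X).submatrix (reverse A M B) (reverse A M B) := by
    ext ⟨b, m, a⟩ ⟨b', m', a'⟩
    simp [onAM, onMB, reverse, mul_comm]
  rw [h, Matrix.submatrix_mulVec_equiv]
  simp [Function.comp_assoc]

theorem onAM_mulVec_comp_reverse (X : Matrix (A × M) (A × M) ℂ) (v : A × M × B → ℂ) :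
    (onAM X *ᵥ v) ∘ reverse A M B =
      onMB (X.submatrix Prod.swap Prod.swap) *ᵥ (v ∘ reverse A M B) := by
  have h : (onMB (X.submatrix Prod.swap Prod.swap) : Matrix (B × M × A) (B × M × A) ℂ) =
      (onAM X).submatrix (reverse A M B) (reverse A M B) := by
    ext ⟨b, m, a⟩ ⟨b', m', a'⟩
    simp [onAM, onMB, reverse, mul_comm]
  rw [h, Matrix.submatrix_mulVec_equiv]
  simp [Function.comp_assoc]

theorem onAB_mulVec_comp_reverse (X : Matrix A A ℂ) (Y : Matrix B B ℂ) (v : A × M × B → ℂ) :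
    (onAB X Y *ᵥ v) ∘ reverse A M B = onAB Y X *ᵥ (v ∘ reverse A M B) := by
  have h : (onAB Y X : Matrix (B × M × A) (B × M × A) ℂ) =
      (onAB X Y).submatrix (reverse A M B) (reverse A M B) := by
    ext ⟨b, m, a⟩ ⟨b', m', a'⟩
    simp only [onAB, reverse, Matrix.kroneckerMap_apply, Matrix.submatrix_apply, Equiv.coe_fn_mk]
    ring
  rw [h, Matrix.submatrix_mulVec_equiv]
  simp [Function.comp_assoc]

theorem braket_comp_equiv {ι κ : Type*} [Fintype ι] [Fintype κ] (e : κ ≃ ι) (v w : ι → ℂ) :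
    braket (v ∘ e) (w ∘ e) = braket v w :=
  comp_equiv_dotProduct_comp_equiv (star v) w e

theorem braket_onAM_mulVec_assoc (Q : Matrix (A × M) (A × M) ℂ) (θ : A × M → ℂ) (b : B → ℂ) :
    braket (fun x : A × M × B => θ (x.1, x.2.1) * b x.2.2)
      (onAM Q *ᵥ fun x => θ (x.1, x.2.1) * b x.2.2) = braket θ (Q *ᵥ θ) * braket b b := by
  rw [onAM_mulVec_assoc, ← braket_tensorVec]
  exact braket_comp_equiv (Equiv.prodAssoc A M B).symm (tensorVec θ b) (tensorVec (Q *ᵥ θ) b)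

theorem submatrix_mem_unitaryGroup {ι κ : Type*} [Fintype ι] [Fintype κ] [DecidableEq ι]
    [DecidableEq κ] (e : κ ≃ ι) {W : Matrix ι ι ℂ} (hW : W ∈ Matrix.unitaryGroup ι ℂ) :
    W.submatrix e e ∈ Matrix.unitaryGroup κ ℂ := by
  rw [Matrix.mem_unitaryGroup_iff, Matrix.star_eq_conjTranspose, Matrix.conjTranspose_submatrix,
    Matrix.submatrix_mul_equiv, ← Matrix.star_eq_conjTranspose, Matrix.mem_unitaryGroup_iff.1 hW,
    Matrix.submatrix_one_equiv]

end Swap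

/-! ### Protocol runs as chains, and the resulting dual sequences -/

namespace Protocol

/-- After round 1, Bob's round `2 * k + 2` and Alice's round `2 * k + 3` together make one chain
step. -/
theorem runB_odd_eq_chainRun (P : Protocol A M B) {d : ℕ} (ω : M × Fin d → ℂ)
    (V W : ℕ → Matrix (M × Fin d) (M × Fin d) ℂ) (j : ℕ) (hVW : ∀ k < j, V (2 * k + 2) = W k) :
    P.runB ω V (2 * j + 1) = chainRun (fun j => P.EA (2 * j + 3) * P.UA (2 * j + 3)) W
      (P.runB ω V 1) j := by
  induction j with
  | zero => rfl
  | succ j ih =>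
    rw [chainRun, ← ih fun k hk => hVW k (by omega), ← hVW j (by omega),
      show 2 * (j + 1) + 1 = 2 * j + 1 + 1 + 1 by ring, runB, if_pos ⟨j + 1, by ring⟩, runB,
      if_neg (by rw [Nat.not_odd_iff_even]; exact ⟨j + 1, by ring⟩)]

/-- Round `n` belongs to Bob, and no operation of Alice but her final measurement follows it. With
the identity there, `r` chain steps remain after round 1. -/
theorem winB_eq (P : Protocol A M B) {d : ℕ} (ω : M × Fin d → ℂ)
    (V W : ℕ → Matrix (M × Fin d) (M × Fin d) ℂ) {r : ℕ} (hr : P.n = 2 * (r + 1))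
    (hVW : ∀ k < r, V (2 * k + 2) = W k) (hV : V P.n = 1) :
    P.winB ω V = (braket (chainRun (fun j => P.EA (2 * j + 3) * P.UA (2 * j + 3)) W
      (P.runB ω V 1) r) (onAB P.FA1 1 *ᵥ chainRun (fun j => P.EA (2 * j + 3) * P.UA (2 * j + 3)) W
      (P.runB ω V 1) r)).re := by
  have h : P.runB ω V P.n = P.runB ω V (2 * r + 1) := by
    rw [hr] at hV ⊢
    rw [show 2 * (r + 1) = 2 * r + 1 + 1 by ring] at hV ⊢
    rw [runB, if_neg (by rw [Nat.not_odd_iff_even]; exact ⟨r + 1, by ring⟩), hV, onMB_one,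
      Matrix.one_mulVec]
  rw [winB, h, P.runB_odd_eq_chainRun ω V W r hVW]

theorem IsWCF.exists_strictChain_early {P : Protocol A M B} (hP : P.IsWCF) {r : ℕ}
    (hr : P.n = 2 * (r + 1)) {t : ℝ} (ht : P.optBEarly < t) :
    ∃ Z, StrictChain (fun j => P.EA (2 * j + 1) * P.UA (2 * j + 1)) P.FA1 (r + 1) Z ∧
      (braket P.ψA (Z 0 *ᵥ P.ψA)).re < t := by
  have hA := nonempty_of_sqNorm_eq_one hP.unit_ψA
  have hM := nonempty_of_sqNorm_eq_one hP.unit_ψM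
  by_contra! hcon
  let k : Fin (Fintype.card (A × M)) := ⟨0, Fintype.card_pos⟩
  let ω₀ : M × Fin (Fintype.card (A × M)) → ℂ := tensorVec P.ψM (Pi.single k 1)
  have hω₀ : sqNorm ω₀ = 1 := by rw [sqNorm_tensorVec, hP.unit_ψM, sqNorm_single, one_mul]
  obtain ⟨W, hW, hle⟩ := exists_unitary_le_chainRun hP.posSemidef_FA1 (t := t) (r + 1)
    (fun j => P.EA (2 * j + 1) * P.UA (2 * j + 1)) (tensorVec P.ψA ω₀) fun Z hZ => by
      rw [onAB_mulVec_tensorVec, Matrix.one_mulVec, braket_tensorVec, braket_self, hω₀,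
        Complex.ofReal_one, mul_one]
      exact hcon Z hZ
  let V : ℕ → Matrix (M × Fin (Fintype.card (A × M))) (M × Fin (Fintype.card (A × M))) ℂ :=
    fun i => if i < P.n then W (i / 2) else 1
  have hV : ∀ i, V i ∈ Matrix.unitaryGroup (M × Fin (Fintype.card (A × M))) ℂ := fun i => by
    by_cases h : i < P.n
    · simp only [V, if_pos h, hW]
    · simp only [V, if_neg h, one_mem]
  -- The first unitary of the chain precedes Alice's round 1. It is absorbed into the initial state,
  -- which is allowed precisely because `optBEarly` admits every joint state.
  have hω : sqNorm (W 0 *ᵥ ω₀) = 1 := by rw [sqNorm_unitary_mulVec (hW 0), hω₀]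
  have hwin := hP.winB_le_optBEarly hω hV
  rw [P.winB_eq (W 0 *ᵥ ω₀) V (fun j => W (j + 1)) hr
    (fun k hk => by
      simp only [V]
      rw [if_pos (by omega), show (2 * k + 2) / 2 = k + 1 by omega])
    (by simp [V])] at hwin
  rw [chainRun_succ'] at hle
  have h1 : P.runB (W 0 *ᵥ ω₀) V 1 =
      onAM (P.EA (2 * 0 + 1) * P.UA (2 * 0 + 1)) *ᵥ (onMB (W 0) *ᵥ tensorVec P.ψA ω₀) := by
    rw [runB, if_pos (by decide), runB, onMB_mulVec_tensorVec]
  rw [h1] at hwin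
  exact absurd (hle.trans hwin) (not_le.2 ht)

/-- Here Bob has no move before round 1, so the chain starts afterwards, at Alice's round 3. The
state after round 1 is then `θ` on Alice's and the message space times Bob's state, and the
expectation of `Z 0` is the same for a cheating Bob as in the honest run. -/
theorem IsWCF.exists_strictChain_honest {P : Protocol A M B} (hP : P.IsWCF) {r : ℕ}
    (hr : P.n = 2 * (r + 1)) {t : ℝ} (ht : P.optB < t) :
    ∃ Z, StrictChain (fun j => P.EA (2 * j + 3) * P.UA (2 * j + 3)) P.FA1 r Z ∧
      (braket (P.honest 1) (onAB (Z 0) 1 *ᵥ P.honest 1)).re < t := by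
  have hA := nonempty_of_sqNorm_eq_one hP.unit_ψA
  have hM := nonempty_of_sqNorm_eq_one hP.unit_ψM
  by_contra! hcon
  let k : Fin (Fintype.card (A × M)) := ⟨0, Fintype.card_pos⟩
  let χ : Fin (Fintype.card (A × M)) → ℂ := Pi.single k 1
  let θ : A × M → ℂ := (P.EA 1 * P.UA 1) *ᵥ tensorVec P.ψA P.ψM
  have hhonest : P.honest 1 = fun x => θ (x.1, x.2.1) * P.ψB x.2.2 := by
    have h1 := hP.E_honest 1 one_pos (by omega)
    rw [← h1, honest, Protocol.E, Protocol.U, if_pos (by decide), if_pos (by decide),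
      Matrix.mulVec_mulVec, ← onAM_mul, ← onAM_mulVec_assoc]
    congr 1
    funext x
    simp [honest, tensorVec, mul_assoc]
  obtain ⟨W, hW, hle⟩ := exists_unitary_le_chainRun hP.posSemidef_FA1 (t := t) r
    (fun j => P.EA (2 * j + 3) * P.UA (2 * j + 3)) (fun x => θ (x.1, x.2.1) * χ x.2.2)
    fun Z hZ => by
      have h1 := hcon Z hZ
      rw [hhonest, ← onAM_kronecker_one, braket_onAM_mulVec_assoc, braket_self P.ψB, hP.unit_ψB] at h1
      rwa [← onAM_kronecker_one, braket_onAM_mulVec_assoc, braket_self χ, sqNorm_single]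
  let V : ℕ → Matrix (M × Fin (Fintype.card (A × M))) (M × Fin (Fintype.card (A × M))) ℂ :=
    -- Only even `i` matter: `i = 2 * k + 2` gives `W k`. Other indices merely have to be unitary.
    fun i => if i < P.n then W (i / 2 - 1) else 1
  have hV : ∀ i, V i ∈ Matrix.unitaryGroup (M × Fin (Fintype.card (A × M))) ℂ := fun i => by
    by_cases h : i < P.n
    · simp only [V, if_pos h, hW]
    · simp only [V, if_neg h, one_mem]
  have hwin := hP.winB_le_optB (sqNorm_single k) hV
  rw [P.winB_eq (tensorVec P.ψM χ) V W hr
    (fun k hk => by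
      simp only [V]
      rw [if_pos (by omega), show (2 * k + 2) / 2 - 1 = k by omega])
    (by simp [V])] at hwin
  have h1 : P.runB (tensorVec P.ψM χ) V 1 = fun x => θ (x.1, x.2.1) * χ x.2.2 := by
    rw [runB, if_pos (by decide), runB, ← onAM_mulVec_assoc]
    congr 1
    funext x
    simp [tensorVec, mul_assoc]
  rw [h1] at hwin
  exact absurd (hle.trans hwin) (not_le.2 ht)

theorem runA_even_eq_chainRun (P : Protocol A M B) {d : ℕ} (ω : Fin d × M → ℂ)
    (V : ℕ → Matrix (Fin d × M) (Fin d × M) ℂ) (W : ℕ → Matrix (M × Fin d) (M × Fin d) ℂ)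
    (hVW : ∀ k, (V (2 * k + 1)).submatrix Prod.swap Prod.swap = W k) (j : ℕ) :
    P.runA ω V (2 * j) ∘ reverse (Fin d) M B =
      chainRun (fun j => (P.EB (2 * j + 2) * P.UB (2 * j + 2)).submatrix Prod.swap Prod.swap) W
        (P.runA ω V 0 ∘ reverse (Fin d) M B) j := by
  induction j with
  | zero => rfl
  | succ j ih =>
    rw [chainRun, ← ih, ← hVW j, show 2 * (j + 1) = 2 * j + 1 + 1 by ring, runA,
      if_neg (by rw [Nat.not_odd_iff_even]; exact ⟨j + 1, by ring⟩), runA,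
      if_pos ⟨j, by ring⟩, onMB_mulVec_comp_reverse, onAM_mulVec_comp_reverse]

theorem IsWCF.exists_strictChain_bob {P : Protocol A M B} (hP : P.IsWCF) {r : ℕ}
    (hr : P.n = 2 * r) {t : ℝ} (ht : P.optA < t) :
    ∃ Z, StrictChain (fun j => (P.EB (2 * j + 2) * P.UB (2 * j + 2)).submatrix Prod.swap Prod.swap)
      P.FB0 r Z ∧ (braket P.ψB (Z 0 *ᵥ P.ψB)).re < t := by
  have hB := nonempty_of_sqNorm_eq_one hP.unit_ψB
  have hM := nonempty_of_sqNorm_eq_one hP.unit_ψM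
  by_contra! hcon
  let k : Fin (Fintype.card (B × M)) := ⟨0, Fintype.card_pos⟩
  let χ : Fin (Fintype.card (B × M)) → ℂ := Pi.single k 1
  have hω : sqNorm (tensorVec χ P.ψM) = 1 := by
    rw [sqNorm_tensorVec, hP.unit_ψM, sqNorm_single, one_mul]
  have hω' : sqNorm (tensorVec P.ψM χ) = 1 := by
    rw [sqNorm_tensorVec, hP.unit_ψM, sqNorm_single, one_mul]
  obtain ⟨W, hW, hle⟩ := exists_unitary_le_chainRun hP.posSemidef_FB0 (t := t) r
    (fun j => (P.EB (2 * j + 2) * P.UB (2 * j + 2)).submatrix Prod.swap Prod.swap)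
    (tensorVec P.ψB (tensorVec P.ψM χ)) fun Z hZ => by
      rw [onAB_mulVec_tensorVec, Matrix.one_mulVec, braket_tensorVec, braket_self, hω',
        Complex.ofReal_one, mul_one]
      exact hcon Z hZ
  let V : ℕ → Matrix (Fin (Fintype.card (B × M)) × M) (Fin (Fintype.card (B × M)) × M) ℂ :=
    -- Alice's round `2 * k + 1` receives `W k`; here the adversary moves first, so all `r` steps
    -- are genuine rounds.
    fun i => (W (i / 2)).submatrix Prod.swap Prod.swap
  have hwin := hP.winA_le_optA hω (V := V)
    fun i => submatrix_mem_unitaryGroup (Equiv.prodComm _ _) (hW _)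
  have hrun := P.runA_even_eq_chainRun (tensorVec χ P.ψM) V W (fun k => by
    simp only [V, Matrix.submatrix_submatrix, Prod.swap_swap_eq, Matrix.submatrix_id_id]
    rw [show (2 * k + 1) / 2 = k by omega]) r
  have h0 : P.runA (tensorVec χ P.ψM) V 0 ∘ reverse (Fin (Fintype.card (B × M))) M B =
      tensorVec P.ψB (tensorVec P.ψM χ) := by
    funext x
    simp only [runA, tensorVec, reverse, Function.comp_apply, Equiv.coe_fn_mk]
    ring
  rw [winA, hr, ← braket_comp_equiv (reverse _ M B), onAB_mulVec_comp_reverse, hrun, h0] at hwin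
  exact absurd (hle.trans hwin) (not_le.2 ht)

end Protocol

end Cheating

/-! ### Spectral distributions of product operators -/

section PointGame

theorem eigProj_eq {ι : Type*} [Fintype ι] [DecidableEq ι] {Z P : Matrix ι ι ℂ} {z : ℝ}
    (hP : P.IsHermitian) (hZP : Z * P = (z : ℂ) • P)
    (h : ∀ w, Z *ᵥ w = (z : ℂ) • w → P *ᵥ w = w) : eigProj Z z = P := by
  have hPP : P * P = P := Matrix.ext_iff_mulVec.2 fun v => by
    rw [← Matrix.mulVec_mulVec]
    exact h _ (by rw [Matrix.mulVec_mulVec, hZP, Matrix.smul_mulVec])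
  refine Matrix.ext_iff_mulVec.2 fun v => eigProj_mulVec_eq ?_ fun w hw => ?_
  · rw [Matrix.mulVec_mulVec, hZP, Matrix.smul_mulVec]
  · rw [← h w hw, star_mulVec_dotProduct, hP.eq, Matrix.mulVec_sub, Matrix.mulVec_mulVec, hPP,
      sub_self, dotProduct_zero]

theorem eigProj_kronecker_one {ι κ : Type*} [Fintype ι] [DecidableEq ι] [Fintype κ]
    [DecidableEq κ] (Z : Matrix ι ι ℂ) (z : ℝ) :
    eigProj (Z ⊗ₖ (1 : Matrix κ κ ℂ)) z = eigProj Z z ⊗ₖ (1 : Matrix κ κ ℂ) := by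
  have hslice : ∀ (X : Matrix ι ι ℂ) (w : ι × κ → ℂ) (k : κ),
      (fun i => ((X ⊗ₖ (1 : Matrix κ κ ℂ)) *ᵥ w) (i, k)) = X *ᵥ fun i => w (i, k) := by
    intro X w k
    funext i
    simp [Matrix.mulVec, dotProduct, Fintype.sum_prod_type, Matrix.one_apply]
  refine eigProj_eq ?_ ?_ fun w hw => ?_
  · rw [Matrix.IsHermitian, Matrix.conjTranspose_kronecker, (eigProj_isHermitian Z z).eq,
      Matrix.conjTranspose_one]
  · rw [← Matrix.mul_kronecker_mul, mul_eigProj, Matrix.one_mul, Matrix.smul_kronecker]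
  · funext ⟨i, k⟩
    have h := hslice Z w k
    rw [hw] at h
    exact (congrFun (hslice _ w k) i).trans (congrFun (eigProj_mulVec_of_eigen h.symm) i)

theorem eigProj_one_kronecker {ι κ : Type*} [Fintype ι] [DecidableEq ι] [Fintype κ]
    [DecidableEq κ] (Z : Matrix ι ι ℂ) (z : ℝ) :
    eigProj ((1 : Matrix κ κ ℂ) ⊗ₖ Z) z = (1 : Matrix κ κ ℂ) ⊗ₖ eigProj Z z := by
  have hslice : ∀ (X : Matrix ι ι ℂ) (w : κ × ι → ℂ) (k : κ),
      (fun i => (((1 : Matrix κ κ ℂ) ⊗ₖ X) *ᵥ w) (k, i)) = X *ᵥ fun i => w (k, i) := by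
    intro X w k
    funext i
    simp [Matrix.mulVec, dotProduct, Fintype.sum_prod_type, Matrix.one_apply]
  refine eigProj_eq ?_ ?_ fun w hw => ?_
  · rw [Matrix.IsHermitian, Matrix.conjTranspose_kronecker, (eigProj_isHermitian Z z).eq,
      Matrix.conjTranspose_one]
  · rw [← Matrix.mul_kronecker_mul, mul_eigProj, Matrix.one_mul, Matrix.kronecker_smul]
  · funext ⟨k, i⟩
    have h := hslice Z w k
    rw [hw] at h
    exact (congrFun (hslice _ w k) i).trans (congrFun (eigProj_mulVec_of_eigen h.symm) i)

theorem prob_of_eigen {ι : Type*} [Fintype ι] [DecidableEq ι] {Z : Matrix ι ι ℂ}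
    (hZ : Z.IsHermitian) {z : ℝ≥0} {v : ι → ℂ} (hv : Z *ᵥ v = ((z : ℝ) : ℂ) • v) (x : ℝ≥0) :
    prob Z v x = if x = z then sqNorm v else 0 := by
  split_ifs with h
  · rw [h, prob, eigProj_mulVec_of_eigen hv, sqNorm_eq_re_braket]
  · rw [prob, eigProj_mulVec_of_ne hZ (fun h' => h (NNReal.coe_injective h')) hv]
    simp [braket]

/-! ### Compression to a single vector -/

section RankOne

variable {ι : Type*} [Fintype ι] [DecidableEq ι]

theorem vecMulVec_self_star_mulVec (ψ v : ι → ℂ) :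
    Matrix.vecMulVec ψ (star ψ) *ᵥ v = braket ψ v • ψ := by
  ext i
  simp only [Matrix.vecMulVec_mulVec, braket]
  simp [mul_comm]

theorem isStarProjection_vecMulVec {ψ : ι → ℂ} (hψ : sqNorm ψ = 1) :
    IsStarProjection (Matrix.vecMulVec ψ (star ψ)) := by
  refine ⟨Matrix.ext_iff_mulVec.2 fun v => ?_,
    (Matrix.posSemidef_vecMulVec_self_star ψ).isHermitian⟩
  rw [← Matrix.mulVec_mulVec, vecMulVec_self_star_mulVec ψ v, Matrix.mulVec_smul,
    vecMulVec_self_star_mulVec, braket_self, hψ, Complex.ofReal_one, one_smul]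

/-- With `E` the projector onto `ψ` and `b` the expectation of `Z`, one has `E * Z * E = b • E`, and
`β - b E = (β - b) + b (1 - E)` with `0 ≤ b < β`. -/
theorem posDef_smul_one_sub_compression {Z : Matrix ι ι ℂ} (hZ : Z.PosSemidef) {ψ : ι → ℂ}
    (hψ : sqNorm ψ = 1) {β : ℝ} (hβ : (braket ψ (Z *ᵥ ψ)).re < β) :
    ((β : ℂ) • (1 : Matrix ι ι ℂ) -
      Matrix.vecMulVec ψ (star ψ) * Z * Matrix.vecMulVec ψ (star ψ)).PosDef := by
  have hb := Complex.nonneg_iff.1 (hZ.dotProduct_mulVec_nonneg ψ)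
  have h1 : Matrix.vecMulVec ψ (star ψ) * Z * Matrix.vecMulVec ψ (star ψ) =
      ((braket ψ (Z *ᵥ ψ)).re : ℂ) • Matrix.vecMulVec ψ (star ψ) := by
    have h2 : ((braket ψ (Z *ᵥ ψ)).re : ℂ) = braket ψ (Z *ᵥ ψ) :=
      Complex.ext rfl (by rw [Complex.ofReal_im]; exact hb.2)
    rw [h2]
    refine Matrix.ext_iff_mulVec.2 fun v => ?_
    rw [← Matrix.mulVec_mulVec, ← Matrix.mulVec_mulVec, Matrix.smul_mulVec,
      vecMulVec_self_star_mulVec ψ v, Matrix.mulVec_smul, Matrix.mulVec_smul,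
      vecMulVec_self_star_mulVec, smul_comm]
  have h3 : (((β - (braket ψ (Z *ᵥ ψ)).re : ℝ) : ℂ) • (1 : Matrix ι ι ℂ)).PosDef :=
    Matrix.PosDef.one.smul (by exact_mod_cast sub_pos.2 hβ)
  have h4 : (((braket ψ (Z *ᵥ ψ)).re : ℂ) • (1 - Matrix.vecMulVec ψ (star ψ))).PosSemidef :=
    (posSemidef_one_sub_of_isStarProjection (isStarProjection_vecMulVec hψ)).smul
      (by exact_mod_cast hb.1)
  rw [h1]
  convert h3.add_posSemidef h4 using 1
  push_cast
  module

/-- Take `β` on the line of `ψ` and a large `c` on its orthogonal complement. The strict gap along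
`ψ` absorbs the off-diagonal part of `Z` through a Schur complement. -/
theorem exists_eigen_majorant {Z : Matrix ι ι ℂ} (hZ : Z.PosSemidef) {ψ : ι → ℂ}
    (hψ : sqNorm ψ = 1) {β : ℝ} (hβ : (braket ψ (Z *ᵥ ψ)).re < β) :
    ∃ Y : Matrix ι ι ℂ, (Y - Z).PosSemidef ∧ Y *ᵥ ψ = (β : ℂ) • ψ := by
  let E := Matrix.vecMulVec ψ (star ψ)
  have hE : IsStarProjection E := isStarProjection_vecMulVec hψ
  have hEh : Eᴴ = E := hE.isSelfAdjoint
  have hEE : E * E = E := hE.isIdempotentElem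
  have hFh : (1 - E)ᴴ = 1 - E := hE.one_sub.isSelfAdjoint
  have hEψ : E *ᵥ ψ = ψ := by
    rw [vecMulVec_self_star_mulVec, braket_self, hψ, Complex.ofReal_one, one_smul]
  obtain ⟨c, -, hc⟩ := exists_fromBlocks_posSemidef (posDef_smul_one_sub_compression hZ hψ hβ)
    (-(E * Z * (1 - E))) (R := (1 - E) * Z * (1 - E)) (by
      rw [Matrix.IsHermitian, Matrix.conjTranspose_mul, Matrix.conjTranspose_mul,
        hZ.isHermitian.eq, hFh, Matrix.mul_assoc])
  refine ⟨(β : ℂ) • E + (c : ℂ) • (1 - E), ?_, ?_⟩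
  -- Sandwiching the block matrix between the column `(E, 1 - E)` and its adjoint reassembles `β E +
  -- c (1 - E) - Z`.
  · convert hc.conjTranspose_mul_mul_same (Matrix.fromRows E (1 - E)) using 1
    rw [Matrix.conjTranspose_fromRows_eq_fromCols_conjTranspose, hEh, hFh,
      Matrix.fromCols_mul_fromBlocks, Matrix.fromCols_mul_fromRows]
    change _ = (E * ((β : ℂ) • 1 - E * Z * E) + _) * E + _
    simp only [Matrix.conjTranspose_neg, Matrix.conjTranspose_mul, hFh, hEh, hZ.isHermitian.eq]
    have e1 : ∀ X, E * (E * X) = E * X := fun X => by rw [← Matrix.mul_assoc, hEE]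
    simp only [Matrix.mul_sub, Matrix.sub_mul, Matrix.add_mul, Matrix.mul_assoc,
      Matrix.mul_one, Matrix.one_mul, hEE, e1, Matrix.mul_neg, Matrix.neg_mul, Matrix.mul_smul,
      Matrix.smul_mul]
    module
  · rw [Matrix.add_mulVec, Matrix.smul_mulVec, Matrix.smul_mulVec, Matrix.sub_mulVec, hEψ,
      Matrix.one_mulVec, sub_self, smul_zero, add_zero]

end RankOne

variable {A M B : Type*} [Fintype A] [DecidableEq A] [Fintype M] [DecidableEq M]
  [Fintype B] [DecidableEq B]

/-- `Z 0` occurs only on the larger side of the first constraint, so it may be enlarged. The length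
`r + 1` keeps it distinct from the prescribed last term. -/
theorem StrictChain.exists_eigen {K : ℕ → Matrix (A × M) (A × M) ℂ} {F : Matrix A A ℂ}
    [Nonempty M] (hF : F.PosSemidef) {r : ℕ} {Z : ℕ → Matrix A A ℂ}
    (hZ : StrictChain K F (r + 1) Z) {ψ : A → ℂ} (hψ : sqNorm ψ = 1) {β : ℝ}
    (hβ : (braket ψ (Z 0 *ᵥ ψ)).re < β) :
    ∃ Z', StrictChain K F (r + 1) Z' ∧ Z' 0 *ᵥ ψ = (β : ℂ) • ψ := by
  obtain ⟨Y, hY, hYψ⟩ := exists_eigen_majorant (hZ.posSemidef hF (Nat.zero_le _)) hψ hβ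
  refine ⟨fun j => Nat.casesOn j Y fun j => Z (j + 1), ⟨hZ.1, fun j hj => ?_⟩, hYψ⟩
  cases j with
  | zero =>
    have h := (hZ.2 0 hj).add_posSemidef (hY.kronecker (Matrix.PosSemidef.one (n := M)))
    have e : Y ⊗ₖ (1 : Matrix M M ℂ) = Z 0 ⊗ₖ 1 + (Y - Z 0) ⊗ₖ 1 := by
      rw [← Matrix.add_kronecker, add_sub_cancel]
    have h' : (Y ⊗ₖ (1 : Matrix M M ℂ) - (K 0)ᴴ * (Z 1 ⊗ₖ (1 : Matrix M M ℂ)) * K 0).PosDef := by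
      rw [e, add_sub_right_comm]
      exact h
    exact h'
  | succ j => exact hZ.2 (j + 1) hj

theorem eigProj_onAB_one_right (Z : Matrix A A ℂ) (z : ℝ) :
    eigProj (onAB Z 1 : Matrix (A × M × B) (A × M × B) ℂ) z = onAB (eigProj Z z) 1 := by
  rw [onAB, onAB, Matrix.one_kronecker_one, eigProj_kronecker_one]

theorem eigProj_onAB_one_left (Z : Matrix B B ℂ) (z : ℝ) :
    eigProj (onAB 1 Z : Matrix (A × M × B) (A × M × B) ℂ) z = onAB 1 (eigProj Z z) := by
  rw [onAB, onAB, eigProj_one_kronecker, eigProj_one_kronecker]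

/-- A row of the joint distribution is a one-matrix distribution in the projected, unnormalized
vector; this reduces horizontal transitions to line transitions. -/
theorem prob₂_eq_prob_left (ZA : Matrix A A ℂ) (ZB : Matrix B B ℂ) (ψ : A × M × B → ℂ)
    (x y : ℝ≥0) :
    prob₂ ZA ZB ψ (x, y) = prob (onAB ZA 1) (onAB 1 (eigProj ZB y) *ᵥ ψ) x := by
  rw [prob, braket_mulVec_mulVec, eigProj_onAB_one_right, onAB_conjTranspose, ← onAB_mul,
    ← onAB_mul, (eigProj_isHermitian ZB y).eq, Matrix.conjTranspose_one, Matrix.mul_one,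
    Matrix.mul_one, Matrix.one_mul, eigProj_mul_self, prob₂]

theorem prob₂_eq_prob_right (ZA : Matrix A A ℂ) (ZB : Matrix B B ℂ) (ψ : A × M × B → ℂ)
    (x y : ℝ≥0) :
    prob₂ ZA ZB ψ (x, y) = prob (onAB 1 ZB) (onAB (eigProj ZA x) 1 *ᵥ ψ) y := by
  rw [prob, braket_mulVec_mulVec, eigProj_onAB_one_left, onAB_conjTranspose, ← onAB_mul,
    ← onAB_mul, (eigProj_isHermitian ZA x).eq, Matrix.conjTranspose_one, Matrix.mul_one,
    Matrix.mul_one, Matrix.one_mul, eigProj_mul_self, prob₂]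

theorem prob₂_nonneg (ZA : Matrix A A ℂ) (ZB : Matrix B B ℂ) (ψ : A × M × B → ℂ)
    (z : ℝ≥0 × ℝ≥0) : 0 ≤ prob₂ ZA ZB ψ z :=
  (onAB_posSemidef (eigProj_posSemidef _ _) (eigProj_posSemidef _ _)).re_dotProduct_nonneg _

theorem finite_support_prob₂ (ZA : Matrix A A ℂ) (ZB : Matrix B B ℂ) (ψ : A × M × B → ℂ) :
    (Function.support (prob₂ ZA ZB ψ)).Finite := by
  refine ((finite_setOf_eigProj_ne_zero ZA).prod (finite_setOf_eigProj_ne_zero ZB)).subset ?_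
  intro z hz
  refine ⟨fun h => hz ?_, fun h => hz ?_⟩
  · simp [prob₂, onAB, h, braket]
  · simp [prob₂, onAB, h, braket]

theorem prob₂_eq_sqNorm (ZA : Matrix A A ℂ) (ZB : Matrix B B ℂ) (ψ : A × M × B → ℂ)
    (z : ℝ≥0 × ℝ≥0) :
    prob₂ ZA ZB ψ z = sqNorm (onAB (eigProj ZA z.1) (eigProj ZB z.2) *ᵥ ψ) := by
  rw [prob₂, sqNorm_eq_re_braket, braket, braket, star_mulVec_dotProduct, Matrix.mulVec_mulVec,
    onAB_conjTranspose, (eigProj_isHermitian _ _).eq, (eigProj_isHermitian _ _).eq, ← onAB_mul,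
    eigProj_mul_self, eigProj_mul_self]

theorem onAB_eigProj_mulVec_of_eigen {ZA : Matrix A A ℂ} {ZB : Matrix B B ℂ} {a b : ℝ≥0}
    {u : A × M × B → ℂ} (ha : onAB ZA 1 *ᵥ u = ((a : ℝ) : ℂ) • u)
    (hb : onAB 1 ZB *ᵥ u = ((b : ℝ) : ℂ) • u) :
    onAB (eigProj ZA a) (eigProj ZB b) *ᵥ u = u := by
  have h1 := eigProj_mulVec_of_eigen ha
  have h2 := eigProj_mulVec_of_eigen hb
  rw [eigProj_onAB_one_right] at h1
  rw [eigProj_onAB_one_left] at h2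
  have h3 : (onAB (eigProj ZA a) (eigProj ZB b) : Matrix (A × M × B) (A × M × B) ℂ) =
      onAB (eigProj ZA a) 1 * onAB 1 (eigProj ZB b) := by
    rw [← onAB_mul, Matrix.mul_one, Matrix.one_mul]
  rw [h3, ← Matrix.mulVec_mulVec, h2, h1]

theorem onAB_sub_left (X X' : Matrix A A ℂ) (Y : Matrix B B ℂ) :
    (onAB (X - X') Y : Matrix (A × M × B) (A × M × B) ℂ) = onAB X Y - onAB X' Y := by
  rw [eq_sub_iff_add_eq, ← onAB_add_left, sub_add_cancel]

theorem onAB_sub_right (X : Matrix A A ℂ) (Y Y' : Matrix B B ℂ) :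
    (onAB X (Y - Y') : Matrix (A × M × B) (A × M × B) ℂ) = onAB X Y - onAB X Y' := by
  rw [eq_sub_iff_add_eq, ← onAB_add_right, sub_add_cancel]

theorem onAB_smul_smul_mulVec (a b : ℂ) (X : Matrix A A ℂ) (Y : Matrix B B ℂ)
    (v : A × M × B → ℂ) : onAB (a • X) (b • Y) *ᵥ v = (a * b) • (onAB X Y *ᵥ v) := by
  rw [onAB, onAB, Matrix.smul_kronecker, Matrix.kronecker_smul, Matrix.kronecker_smul, smul_smul,
    Matrix.smul_mulVec]

/-! ### Transitions and endpoints coming from a protocol -/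

namespace Protocol

/-- Alice's unitary and projector commute with Bob's spectral projector, so each projected honest
state still satisfies the assumptions of `EBMLine.of_compression`. -/
theorem IsWCF.ebmHorizontal {P : Protocol A M B} (hP : P.IsWCF) {i : ℕ} (hi : Odd (i + 1))
    (hin : i + 1 ≤ P.n) {Z Z' : Matrix A A ℂ} (ZB : Matrix B B ℂ) (hZ : Z.PosSemidef)
    (h : (Z' ⊗ₖ (1 : Matrix M M ℂ) - (P.EA (i + 1) * P.UA (i + 1))ᴴ *
      (Z ⊗ₖ (1 : Matrix M M ℂ)) * (P.EA (i + 1) * P.UA (i + 1))).PosDef) :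
    EBMHorizontal (prob₂ Z ZB (P.honest (i + 1))) (prob₂ Z' ZB (P.honest i)) := by
  intro y
  simp only [prob₂_eq_prob_left]
  have hE := hP.E_honest (i + 1) (Nat.succ_pos i) hin
  rw [Protocol.E, if_pos hi] at hE
  have hproj := hP.proj_EA _ hi hin
  have hU : onAM (P.UA (i + 1)) *ᵥ (onAB 1 (eigProj ZB y) *ᵥ P.honest i) =
      onAB 1 (eigProj ZB y) *ᵥ P.honest (i + 1) := by
    rw [Matrix.mulVec_mulVec, onAM_mul_onAB_one, ← Matrix.mulVec_mulVec, honest, Protocol.U,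
      if_pos hi]
  have key := EBMLine.of_compression (Z := onAB Z 1) (Y := onAB Z' 1)
    (U := onAM (P.UA (i + 1))) (E := onAM (P.EA (i + 1)))
    (φ := onAB 1 (eigProj ZB y) *ᵥ P.honest i) (onAB_posSemidef hZ Matrix.PosSemidef.one)
    (onAM_mem_unitaryGroup (hP.unitary_UA _ hi hin))
    (isStarProjection_onAM hproj)
    (by rw [hU, Matrix.mulVec_mulVec, onAM_mul_onAB_one, ← Matrix.mulVec_mulVec, hE])
    (by
      convert onAM_posDef (B := B) h using 1
      have hEh : (P.EA (i + 1))ᴴ = P.EA (i + 1) := hproj.isSelfAdjoint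
      rw [onAM_sub, onAM_kronecker_one, Matrix.conjTranspose_mul, hEh]
      simp only [onAM_mul, onAM_kronecker_one, onAM_conjTranspose, Matrix.mul_assoc])
  rwa [hU] at key

theorem IsWCF.ebmVertical {P : Protocol A M B} (hP : P.IsWCF) {i : ℕ} (hi : Even (i + 1))
    (hin : i + 1 ≤ P.n) {Z Z' : Matrix B B ℂ} (ZA : Matrix A A ℂ) (hZ : Z.PosSemidef)
    (h : ((1 : Matrix M M ℂ) ⊗ₖ Z' - (P.EB (i + 1) * P.UB (i + 1))ᴴ *
      ((1 : Matrix M M ℂ) ⊗ₖ Z) * (P.EB (i + 1) * P.UB (i + 1))).PosDef) :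
    EBMVertical (prob₂ ZA Z (P.honest (i + 1))) (prob₂ ZA Z' (P.honest i)) := by
  intro x
  simp only [prob₂_eq_prob_right]
  have hi' : ¬ Odd (i + 1) := Nat.not_odd_iff_even.2 hi
  have hE := hP.E_honest (i + 1) (Nat.succ_pos i) hin
  rw [Protocol.E, if_neg hi'] at hE
  have hproj := hP.proj_EB _ hi (Nat.succ_pos i) hin
  have hU : onMB (P.UB (i + 1)) *ᵥ (onAB (eigProj ZA x) 1 *ᵥ P.honest i) =
      onAB (eigProj ZA x) 1 *ᵥ P.honest (i + 1) := by
    rw [Matrix.mulVec_mulVec, onMB_mul_onAB_one, ← Matrix.mulVec_mulVec, honest, Protocol.U,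
      if_neg hi']
  have key := EBMLine.of_compression (Z := onAB 1 Z) (Y := onAB 1 Z')
    (U := onMB (P.UB (i + 1))) (E := onMB (P.EB (i + 1)))
    (φ := onAB (eigProj ZA x) 1 *ᵥ P.honest i) (onAB_posSemidef Matrix.PosSemidef.one hZ)
    (onMB_mem_unitaryGroup (hP.unitary_UB _ hi (Nat.succ_pos i) hin))
    (isStarProjection_onMB hproj)
    (by rw [hU, Matrix.mulVec_mulVec, onMB_mul_onAB_one, ← Matrix.mulVec_mulVec, hE])
    (by
      convert onMB_posDef (A := A) h using 1
      have hEh : (P.EB (i + 1))ᴴ = P.EB (i + 1) := hproj.isSelfAdjoint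
      rw [onMB_sub, onMB_one_kronecker, Matrix.conjTranspose_mul, hEh]
      simp only [onMB_mul, onMB_one_kronecker, onMB_conjTranspose, Matrix.mul_assoc])
  rwa [hU] at key

theorem IsWCF.prob₂_final {P : Protocol A M B} (hP : P.IsWCF) {ZA : Matrix A A ℂ}
    {ZB : Matrix B B ℂ} (hA : ZA.IsHermitian) (hB : ZB.IsHermitian) {β α : ℝ≥0}
    (hβ : ZA *ᵥ P.ψA = ((β : ℝ) : ℂ) • P.ψA) (hα : ZB *ᵥ P.ψB = ((α : ℝ) : ℂ) • P.ψB) :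
    prob₂ ZA ZB (P.honest 0) = point β α := by
  funext ⟨x, y⟩
  have h : prob₂ ZA ZB (P.honest 0) (x, y) = prob ZA P.ψA x * prob ZB P.ψB y := by
    rw [prob₂, honest, onAB_mulVec_tensorVec, braket_tensorVec, braket_tensorVec, braket_self,
      hP.unit_ψM, Complex.ofReal_one, one_mul, prob, prob, Complex.mul_re]
    have him := (Complex.nonneg_iff.1
      ((eigProj_posSemidef ZA x).dotProduct_mulVec_nonneg P.ψA)).2
    have him' : (braket P.ψA (eigProj ZA x *ᵥ P.ψA)).im = 0 := him.symm
    rw [him', zero_mul, sub_zero]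
  rw [h, prob_of_eigen hA hβ, prob_of_eigen hB hα, hP.unit_ψA, hP.unit_ψB, point]
  by_cases hx : x = β <;> by_cases hy : y = α <;> simp [hx, hy]

/-- Without messages the outcomes are independent, so excluding one disagreement excludes one of the
two agreements. -/
theorem IsWCF.n_ne_zero {P : Protocol A M B} (hP : P.IsWCF) : P.n ≠ 0 := by
  intro h
  have h1 := congrArg sqNorm hP.correct_01
  have h2 := hP.balanced_A
  have h3 := hP.balanced_B
  rw [h, honest, onAB_mulVec_tensorVec, sqNorm_tensorVec, sqNorm_tensorVec, hP.unit_ψM] at h1 h2 h3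
  rw [sqNorm_zero, one_mul, mul_eq_zero] at h1
  rcases h1 with h1 | h1
  · rw [h1] at h2; norm_num at h2
  · rw [h1] at h3; norm_num at h3

/-- The POVMs need not be projective, so other eigenvalues must be excluded. The component of the
final state at eigenvalues `(x, y)` is multiplied by `x * y` under `FA1 ⊗ FB0` and by `(1 - x) * (1
- y)` under `FA0 ⊗ FB1`; both products annihilate it by correctness, leaving only `(0, 1)` and `(1,
0)`. -/
theorem IsWCF.prob₂_init {P : Protocol A M B} (hP : P.IsWCF) :
    prob₂ P.FA1 P.FB0 (P.honest P.n) = (1 / 2 : ℝ) • point 0 1 + (1 / 2 : ℝ) • point 1 0 := by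
  have hA0 : P.FA0 = 1 - P.FA1 := eq_sub_of_add_eq hP.sum_FA
  have hB1 : P.FB1 = 1 - P.FB0 := eq_sub_of_add_eq' hP.sum_FB
  have cA : P.FA1 * P.FA0 = P.FA0 * P.FA1 := by
    rw [hA0, Matrix.mul_sub, Matrix.sub_mul, Matrix.mul_one, Matrix.one_mul]
  have cB : P.FB0 * P.FB1 = P.FB1 * P.FB0 := by
    rw [hB1, Matrix.mul_sub, Matrix.sub_mul, Matrix.mul_one, Matrix.one_mul]
  have pA1 : ∀ x : ℝ, eigProj P.FA1 x * P.FA1 = (x : ℂ) • eigProj P.FA1 x :=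
    eigProj_mul hP.posSemidef_FA1.isHermitian
  have pB0 : ∀ x : ℝ, eigProj P.FB0 x * P.FB0 = (x : ℂ) • eigProj P.FB0 x :=
    eigProj_mul hP.posSemidef_FB0.isHermitian
  have pA0 : ∀ x : ℝ, eigProj P.FA1 x * P.FA0 = (1 - x : ℂ) • eigProj P.FA1 x := fun x => by
    rw [hA0, Matrix.mul_sub, pA1, Matrix.mul_one, sub_smul, one_smul]
  have pB1 : ∀ x : ℝ, eigProj P.FB0 x * P.FB1 = (1 - x : ℂ) • eigProj P.FB0 x := fun x => by
    rw [hB1, Matrix.mul_sub, pB0, Matrix.mul_one, sub_smul, one_smul]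
  have h01 : prob₂ P.FA1 P.FB0 (P.honest P.n) (0, 1) = 1 / 2 := by
    rw [prob₂_eq_sqNorm, ← hP.balanced_A]
    congr 1
    -- By correctness `FA0 ⊗ FB0` already maps the final state into the joint eigenspace for `(0,
    -- 1)`, so it agrees with the eigenprojection there and the balance condition gives the weight.
    have h1 := onAB_eigProj_mulVec_of_eigen (ZA := P.FA1) (ZB := P.FB0) (a := 0) (b := 1)
      (u := onAB P.FA0 P.FB0 *ᵥ P.honest P.n)
      (by
        rw [Matrix.mulVec_mulVec, ← onAB_mul, Matrix.one_mul, cA]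
        have := congrArg (fun v => onAB P.FA0 1 *ᵥ v) hP.correct_10
        simpa [Matrix.mulVec_mulVec, ← onAB_mul] using this)
      (by
        have := congrArg (fun v => onAB 1 P.FB0 *ᵥ v) hP.correct_01
        simp only [Matrix.mulVec_mulVec, ← onAB_mul, Matrix.one_mul, hB1, Matrix.mul_sub,
          Matrix.mul_one, Matrix.mulVec_zero] at this
        rw [onAB_sub_right, Matrix.sub_mulVec, sub_eq_zero] at this
        rw [Matrix.mulVec_mulVec, ← onAB_mul, Matrix.one_mul, ← this]
        simp)
    rw [← h1, Matrix.mulVec_mulVec, ← onAB_mul, pA0, pB0]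
    simp
  have h10 : prob₂ P.FA1 P.FB0 (P.honest P.n) (1, 0) = 1 / 2 := by
    rw [prob₂_eq_sqNorm, ← hP.balanced_B]
    congr 1
    have h1 := onAB_eigProj_mulVec_of_eigen (ZA := P.FA1) (ZB := P.FB0) (a := 1) (b := 0)
      (u := onAB P.FA1 P.FB1 *ᵥ P.honest P.n)
      (by
        have := congrArg (fun v => onAB P.FA1 1 *ᵥ v) hP.correct_01
        simp only [Matrix.mulVec_mulVec, ← onAB_mul, Matrix.one_mul, hA0, Matrix.mul_sub,
          Matrix.mul_one, Matrix.mulVec_zero] at this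
        rw [onAB_sub_left, Matrix.sub_mulVec, sub_eq_zero] at this
        rw [Matrix.mulVec_mulVec, ← onAB_mul, Matrix.one_mul, ← this]
        simp)
      (by
        rw [Matrix.mulVec_mulVec, ← onAB_mul, Matrix.one_mul, cB]
        have := congrArg (fun v => onAB 1 P.FB1 *ᵥ v) hP.correct_10
        simpa [Matrix.mulVec_mulVec, ← onAB_mul] using this)
    rw [← h1, Matrix.mulVec_mulVec, ← onAB_mul, pA1, pB1]
    simp
  funext ⟨x, y⟩
  by_cases hc0 : x = 0 ∧ y = 1
  · rw [hc0.1, hc0.2, h01]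
    simp [point]
  by_cases hc1 : x = 1 ∧ y = 0
  · rw [hc1.1, hc1.2, h10]
    simp [point]
  have e1 : ((x : ℝ) * (y : ℝ) : ℂ) • (onAB (eigProj P.FA1 x) (eigProj P.FB0 y) *ᵥ P.honest P.n)
      = 0 := by
    rw [← onAB_smul_smul_mulVec, ← pA1, ← pB0, onAB_mul, ← Matrix.mulVec_mulVec, hP.correct_10,
      Matrix.mulVec_zero]
  have e2 : ((1 - (x : ℝ)) * (1 - (y : ℝ)) : ℂ) •
      (onAB (eigProj P.FA1 x) (eigProj P.FB0 y) *ᵥ P.honest P.n) = 0 := by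
    rw [← onAB_smul_smul_mulVec, ← pA0, ← pB1, onAB_mul, ← Matrix.mulVec_mulVec, hP.correct_01,
      Matrix.mulVec_zero]
  have hv : onAB (eigProj P.FA1 x) (eigProj P.FB0 y) *ᵥ P.honest P.n = 0 := by
    by_contra hv
    have f1 := (smul_eq_zero.1 e1).resolve_right hv
    have f2 := (smul_eq_zero.1 e2).resolve_right hv
    have f1' : x * y = 0 := by exact_mod_cast f1
    have f2' : (1 - (x : ℝ)) * (1 - (y : ℝ)) = 0 := by exact_mod_cast f2
    rcases mul_eq_zero.1 f1' with h | h
    · rw [h, NNReal.coe_zero, sub_zero, one_mul, sub_eq_zero] at f2'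
      exact hc0 ⟨h, by exact_mod_cast f2'.symm⟩
    · rw [h, NNReal.coe_zero, sub_zero, mul_one, sub_eq_zero] at f2'
      exact hc1 ⟨by exact_mod_cast f2'.symm, h⟩
  rw [prob₂, hv]
  simp [point, braket, hc0, hc1]

end Protocol

end PointGame

/-! ### Assembling dual feasible points and point games -/

section Main

variable {A M B : Type*} [Fintype A] [DecidableEq A] [Fintype M] [DecidableEq M]
  [Fintype B] [DecidableEq B]

theorem posDef_one_kronecker_sub_of_swap {Z Z' : Matrix B B ℂ} {K : Matrix (M × B) (M × B) ℂ}
    (h : (Z' ⊗ₖ (1 : Matrix M M ℂ) - (K.submatrix Prod.swap Prod.swap)ᴴ *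
      (Z ⊗ₖ (1 : Matrix M M ℂ)) * K.submatrix Prod.swap Prod.swap).PosDef) :
    ((1 : Matrix M M ℂ) ⊗ₖ Z' - Kᴴ * ((1 : Matrix M M ℂ) ⊗ₖ Z) * K).PosDef := by
  have hs : ∀ X : Matrix B B ℂ, (X ⊗ₖ (1 : Matrix M M ℂ)) =
      ((1 : Matrix M M ℂ) ⊗ₖ X).submatrix (Equiv.prodComm B M) (Equiv.prodComm B M) := by
    intro X
    ext ⟨b, m⟩ ⟨b', m'⟩
    simp [mul_comm]
  have hK : K.submatrix Prod.swap Prod.swap =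
      K.submatrix (Equiv.prodComm B M) (Equiv.prodComm B M) := rfl
  rw [hs, hs, hK, Matrix.conjTranspose_submatrix, Matrix.submatrix_mul_equiv,
    Matrix.submatrix_mul_equiv] at h
  have h1 := h.submatrix (Equiv.prodComm M B).injective
  convert h1 using 1
  ext ⟨m, b⟩ ⟨m', b'⟩
  rfl

namespace Protocol

/-- Compressing `ZA ⊗ 1` onto the line of the honest state after round 1 gives less than `β • 1`, so
all points merge at `β` in one transition. Bob has not acted yet, so this state still lies in the
eigenspace of `ZB` for `α` and only the row `y = α` is nonzero. -/
theorem IsWCF.ebmHorizontal_point {P : Protocol A M B} (hP : P.IsWCF) {ZA : Matrix A A ℂ}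
    (hZA : ZA.PosSemidef) {ZB : Matrix B B ℂ} (hZB : ZB.IsHermitian) {β α : ℝ≥0}
    (hα : ZB *ᵥ P.ψB = ((α : ℝ) : ℂ) • P.ψB)
    (hβ : (braket (P.honest 1) (onAB ZA 1 *ᵥ P.honest 1)).re < β) :
    EBMHorizontal (prob₂ ZA ZB (P.honest 1)) (point β α) := by
  have hn : 1 ≤ P.n := Nat.one_le_iff_ne_zero.2 hP.n_ne_zero
  have hone : P.honest 1 = onAM (P.UA 1) *ᵥ P.honest 0 := by
    have hU : P.U 1 = onAM (P.UA 1) := if_pos (by decide)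
    rw [← hU]
    rfl
  have hunit : sqNorm (P.honest 1) = 1 := by
    rw [hone,
      sqNorm_unitary_mulVec (onAM_mem_unitaryGroup (hP.unitary_UA 1 (by decide) hn)), honest,
      sqNorm_tensorVec, sqNorm_tensorVec, hP.unit_ψA, hP.unit_ψM, hP.unit_ψB]
    norm_num
  intro y
  simp only [prob₂_eq_prob_left]
  have hφ : onAB 1 (eigProj ZB y) *ᵥ P.honest 1 = if y = α then P.honest 1 else 0 := by
    have h1 : onAB 1 (eigProj ZB y) *ᵥ P.honest 1 =
        onAM (P.UA 1) *ᵥ (onAB 1 (eigProj ZB y) *ᵥ P.honest 0) := by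
      rw [hone, Matrix.mulVec_mulVec, ← onAM_mul_onAB_one, ← Matrix.mulVec_mulVec]
    rw [h1, honest, onAB_mulVec_tensorVec, Matrix.one_mulVec]
    split_ifs with hy
    · rw [hy, eigProj_mulVec_of_eigen hα, hone, honest]
    · rw [eigProj_mulVec_of_ne hZB (fun h => hy (NNReal.coe_injective h)) hα]
      have h0 : tensorVec P.ψA (tensorVec P.ψM (0 : B → ℂ)) = 0 := by
        funext x
        simp [tensorVec]
      rw [h0, Matrix.mulVec_zero]
  have key := EBMLine.of_compression (Z := onAB ZA 1) (Y := ((β : ℝ) : ℂ) • 1) (U := 1)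
    (E := Matrix.vecMulVec (P.honest 1) (star (P.honest 1)))
    (φ := onAB 1 (eigProj ZB y) *ᵥ P.honest 1) (onAB_posSemidef hZA Matrix.PosSemidef.one)
    (one_mem _) (isStarProjection_vecMulVec hunit)
    (by
      rw [Matrix.one_mulVec, hφ]
      split_ifs
      · rw [vecMulVec_self_star_mulVec, braket_self, hunit, Complex.ofReal_one, one_smul]
      · rw [Matrix.mulVec_zero])
    (by
      rw [Matrix.conjTranspose_one, Matrix.one_mul, Matrix.mul_one]
      exact posDef_smul_one_sub_compression (onAB_posSemidef hZA Matrix.PosSemidef.one) hunit hβ)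
  rw [Matrix.one_mulVec] at key
  convert key using 1
  funext x
  rw [prob_of_eigen (z := β) (by
    rw [Matrix.IsHermitian, Matrix.conjTranspose_smul, Matrix.conjTranspose_one,
      Complex.star_def, Complex.conj_ofReal]) (by rw [Matrix.smul_mulVec, Matrix.one_mulVec]), hφ,
    point]
  by_cases hx : x = β <;> by_cases hy : y = α <;> simp [hx, hy, hunit, sqNorm_zero]

theorem IsWCF.exists_isDualFeasibleA {P : Protocol A M B} (hP : P.IsWCF) {β : ℝ}
    (hβ : P.optBEarly < β) :
    ∃ ZA, P.IsDualFeasibleA ZA β ∧ ∀ i, Odd (i + 1) → i + 1 ≤ P.n →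
      (ZA i ⊗ₖ (1 : Matrix M M ℂ) - (P.EA (i + 1) * P.UA (i + 1))ᴴ *
        (ZA (i + 1) ⊗ₖ (1 : Matrix M M ℂ)) * (P.EA (i + 1) * P.UA (i + 1))).PosDef := by
  have hM := nonempty_of_sqNorm_eq_one hP.unit_ψM
  obtain ⟨s, hs⟩ := hP.even_n
  obtain ⟨r, rfl⟩ : ∃ r, s = r + 1 := ⟨s - 1, by have := hP.n_ne_zero; omega⟩
  have hr : P.n = 2 * (r + 1) := by omega
  obtain ⟨Z, hZ, hlt⟩ := hP.exists_strictChain_early hr hβ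
  obtain ⟨c, hc, hcψ⟩ := hZ.exists_eigen hP.posSemidef_FA1 hP.unit_ψA hlt
  have hstrict : ∀ i, Odd (i + 1) → i + 1 ≤ P.n →
      (c ((i + 1) / 2) ⊗ₖ (1 : Matrix M M ℂ) - (P.EA (i + 1) * P.UA (i + 1))ᴴ *
        (c ((i + 1 + 1) / 2) ⊗ₖ (1 : Matrix M M ℂ)) * (P.EA (i + 1) * P.UA (i + 1))).PosDef := by
    rintro i ⟨j, hj⟩ hi
    have h := hc.2 j (by omega)
    rw [show (i + 1) / 2 = j by omega, show (i + 1 + 1) / 2 = j + 1 by omega, hj]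
    exact h
  -- Each chain matrix after the first is used at an odd round and at the following even one: `c 0,
  -- c 1, c 1, c 2, c 2, …`.
  refine ⟨fun i => c ((i + 1) / 2), ⟨fun i hi => ?_, fun i hi hin => ?_, fun i hi h0 hin => ?_,
    ?_, lt_of_le_of_lt hP.optBEarly_nonneg hβ, by simpa using hcψ⟩, hstrict⟩
  · exact hc.posSemidef hP.posSemidef_FA1 (by omega)
  · obtain ⟨k, rfl⟩ : ∃ k, i = k + 1 := ⟨i - 1, by have := hi.pos; omega⟩
    have h := (hstrict k hi hin).posSemidef
    have hE : (P.EA (k + 1))ᴴ = P.EA (k + 1) := (hP.proj_EA _ hi hin).isSelfAdjoint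
    rw [Matrix.conjTranspose_mul, hE] at h
    simpa only [Nat.add_sub_cancel, Matrix.mul_assoc] using h
  · obtain ⟨k, hk⟩ := hi
    congr 1
    omega
  · rw [show (P.n + 1) / 2 = r + 1 by omega]
    exact hc.1

theorem IsWCF.exists_isDualFeasibleB {P : Protocol A M B} (hP : P.IsWCF) {α : ℝ}
    (hα : P.optA < α) :
    ∃ ZB, P.IsDualFeasibleB ZB α ∧ ∀ i, Even (i + 1) → i + 1 ≤ P.n →
      ((1 : Matrix M M ℂ) ⊗ₖ ZB i - (P.EB (i + 1) * P.UB (i + 1))ᴴ *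
        ((1 : Matrix M M ℂ) ⊗ₖ ZB (i + 1)) * (P.EB (i + 1) * P.UB (i + 1))).PosDef := by
  have hM := nonempty_of_sqNorm_eq_one hP.unit_ψM
  obtain ⟨s, hs⟩ := hP.even_n
  obtain ⟨r, rfl⟩ : ∃ r, s = r + 1 := ⟨s - 1, by have := hP.n_ne_zero; omega⟩
  have hr : P.n = 2 * (r + 1) := by omega
  obtain ⟨Z, hZ, hlt⟩ := hP.exists_strictChain_bob hr hα
  obtain ⟨c, hc, hcψ⟩ := hZ.exists_eigen hP.posSemidef_FB0 hP.unit_ψB hlt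
  have hstrict : ∀ i, Even (i + 1) → i + 1 ≤ P.n →
      ((1 : Matrix M M ℂ) ⊗ₖ c (i / 2) - (P.EB (i + 1) * P.UB (i + 1))ᴴ *
        ((1 : Matrix M M ℂ) ⊗ₖ c ((i + 1) / 2)) * (P.EB (i + 1) * P.UB (i + 1))).PosDef := by
    rintro i ⟨j, hj⟩ hi
    obtain ⟨k, rfl⟩ : ∃ k, j = k + 1 := ⟨j - 1, by omega⟩
    have h := posDef_one_kronecker_sub_of_swap (hc.2 k (by omega))
    rw [show i / 2 = k by omega, show (i + 1) / 2 = k + 1 by omega,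
      show i + 1 = 2 * k + 2 by omega]
    exact h
  -- For Bob the matrices change at even rounds: `c 0, c 0, c 1, c 1, …`.
  refine ⟨fun i => c (i / 2), ⟨fun i hi => ?_, fun i hi h0 hin => ?_, fun i hi hin => ?_,
    ?_, lt_of_le_of_lt hP.optA_nonneg hα, by simpa using hcψ⟩, hstrict⟩
  · exact hc.posSemidef hP.posSemidef_FB0 (by omega)
  · obtain ⟨k, rfl⟩ : ∃ k, i = k + 1 := ⟨i - 1, by omega⟩
    have h := (hstrict k hi hin).posSemidef
    have hE : (P.EB (k + 1))ᴴ = P.EB (k + 1) := (hP.proj_EB _ hi h0 hin).isSelfAdjoint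
    rw [Matrix.conjTranspose_mul, hE] at h
    simpa only [Nat.add_sub_cancel, Matrix.mul_assoc] using h
  · obtain ⟨k, hk⟩ := hi
    congr 1
    omega
  · rw [show P.n / 2 = r + 1 by omega]
    exact hc.1

theorem IsWCF.ebmVertical_of_dual {P : Protocol A M B} (hP : P.IsWCF) {ZA : ℕ → Matrix A A ℂ}
    {ZB : ℕ → Matrix B B ℂ} {α : ℝ} (hB : P.IsDualFeasibleB ZB α)
    (hstrict : ∀ i, Even (i + 1) → i + 1 ≤ P.n →
      ((1 : Matrix M M ℂ) ⊗ₖ ZB i - (P.EB (i + 1) * P.UB (i + 1))ᴴ *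
        ((1 : Matrix M M ℂ) ⊗ₖ ZB (i + 1)) * (P.EB (i + 1) * P.UB (i + 1))).PosDef)
    (hA : ∀ i, Even (i + 1) → i + 1 ≤ P.n → ZA i = ZA (i + 1)) {i : ℕ} (hi : i < P.n)
    (hie : Even i) :
    EBMVertical (prob₂ (ZA (P.n - i)) (ZB (P.n - i)) (P.honest (P.n - i)))
      (prob₂ (ZA (P.n - (i + 1))) (ZB (P.n - (i + 1))) (P.honest (P.n - (i + 1)))) := by
  obtain ⟨k, hk⟩ : ∃ k, P.n - i = k + 1 := ⟨P.n - i - 1, by omega⟩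
  have hk' : P.n - (i + 1) = k := by omega
  have hke : Even (k + 1) := by rw [← hk]; exact (Nat.even_sub hi.le).2 (iff_of_true hP.even_n hie)
  rw [hk, hk', hA k hke (by omega)]
  exact hP.ebmVertical hke (by omega) _ (hB.posSemidef _ (by omega)) (hstrict k hke (by omega))

theorem IsWCF.ebmHorizontal_of_strict {P : Protocol A M B} (hP : P.IsWCF)
    {ZA : ℕ → Matrix A A ℂ} {ZB : ℕ → Matrix B B ℂ} {α : ℝ} (hB : P.IsDualFeasibleB ZB α) {i : ℕ}
    (hi : i < P.n) (hio : Odd i) (hA : (ZA (P.n - i)).PosSemidef)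
    (hstrict : ∀ k, k + 1 = P.n - i → Odd (k + 1) →
      (ZA k ⊗ₖ (1 : Matrix M M ℂ) - (P.EA (k + 1) * P.UA (k + 1))ᴴ *
        (ZA (k + 1) ⊗ₖ (1 : Matrix M M ℂ)) * (P.EA (k + 1) * P.UA (k + 1))).PosDef) :
    EBMHorizontal (prob₂ (ZA (P.n - i)) (ZB (P.n - i)) (P.honest (P.n - i)))
      (prob₂ (ZA (P.n - (i + 1))) (ZB (P.n - (i + 1))) (P.honest (P.n - (i + 1)))) := by
  obtain ⟨k, hk⟩ : ∃ k, P.n - i = k + 1 := ⟨P.n - i - 1, by omega⟩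
  have hk' : P.n - (i + 1) = k := by omega
  have hko : Odd (k + 1) := by
    rw [← hk]
    exact Nat.Even.sub_odd hi.le hP.even_n hio
  have hZB := hB.odd_step (k + 1) hko (by omega)
  rw [Nat.add_sub_cancel] at hZB
  rw [hk] at hA
  rw [hk, hk', hZB]
  exact hP.ebmHorizontal hko (by omega) _ hA (hstrict k hk.symm hko)

theorem IsWCF.exists_isEBMPointGame {P : Protocol A M B} (hP : P.IsWCF) {β α : ℝ≥0}
    (hβ : P.optB < β) (hα : P.optA < α) :
    ∃ p : ℕ → ℝ≥0 × ℝ≥0 → ℝ, IsEBMPointGame P.n p β α := by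
  have hM := nonempty_of_sqNorm_eq_one hP.unit_ψM
  obtain ⟨s, hs⟩ := hP.even_n
  obtain ⟨r, rfl⟩ : ∃ r, s = r + 1 := ⟨s - 1, by have := hP.n_ne_zero; omega⟩
  have hr : P.n = 2 * (r + 1) := by omega
  obtain ⟨c, hc, hlt⟩ := hP.exists_strictChain_honest hr hβ
  obtain ⟨ZB, hB, hBs⟩ := hP.exists_isDualFeasibleB hα
  -- The chain starts after round 1, so `c 0` serves rounds 1 and 2. The value at `0` is never used,
  -- since the last configuration is set to `point β α` directly.
  let ZA : ℕ → Matrix A A ℂ := fun i => c ((i - 1) / 2)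
  refine ⟨fun i => if i < P.n then
    prob₂ (ZA (P.n - i)) (ZB (P.n - i)) (P.honest (P.n - i)) else point β α, ⟨?_, ?_, ?_, ?_, ?_, ?_⟩⟩
  · intro i _ z
    by_cases h : i < P.n
    · simp only [if_pos h]
      exact prob₂_nonneg _ _ _ _
    · simp only [if_neg h, point]
      split_ifs <;> norm_num
  · intro i _
    by_cases h : i < P.n
    · simp only [if_pos h]
      exact finite_support_prob₂ _ _ _
    · simp only [if_neg h]
      refine (Set.finite_singleton (β, α)).subset fun z hz => ?_
      by_contra hz'
      exact hz (if_neg hz')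
  · have h1 : ZA P.n = P.FA1 := by
      simp only [ZA]
      rw [show (P.n - 1) / 2 = r by omega]
      exact hc.1
    simp only [if_pos (show 0 < P.n by omega), Nat.sub_zero]
    rw [h1, hB.last, hP.prob₂_init]
  · intro i hi hie
    have hlt : i + 1 < P.n := by
      obtain ⟨k, hk⟩ := hie
      omega
    simp only [if_pos hi, if_pos hlt]
    refine hP.ebmVertical_of_dual hB hBs (fun k hk _ => ?_) hi hie
    obtain ⟨l, hl⟩ := hk
    simp only [ZA]
    congr 1
    omega
  · intro i hi hio
    have hpsd : (ZA (P.n - i)).PosSemidef := hc.posSemidef hP.posSemidef_FA1 (by omega)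
    by_cases h : i + 1 < P.n
    · simp only [if_pos hi, if_pos h]
      refine hP.ebmHorizontal_of_strict hB hi hio hpsd fun k hk hko => ?_
      obtain ⟨l, hl⟩ := hko
      obtain ⟨j, rfl⟩ : ∃ j, l = j + 1 := ⟨l - 1, by omega⟩
      simp only [ZA]
      rw [show (k - 1) / 2 = j by omega, show (k + 1 - 1) / 2 = j + 1 by omega,
        show k + 1 = 2 * j + 3 by omega]
      exact hc.2 j (by omega)
    -- The last transition corresponds to Alice's round 1, where no dual inequality is available,
    -- and merges to the final point.
    · simp only [if_pos hi, if_neg h]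
      rw [show P.n - i = 1 by omega] at hpsd ⊢
      have hB0 : ZB 0 = ZB 1 := hB.odd_step 1 (by decide) (by omega)
      refine hP.ebmHorizontal_point hpsd (hB.posSemidef 1 (by omega)).isHermitian
        (hB0 ▸ hB.eigen) hlt
  · simp

end Protocol

end Main

end CoinFlip

theorem mainTheorem10 {A M B : Type*} [Fintype A] [DecidableEq A] [Fintype M] [DecidableEq M]
    [Fintype B] [DecidableEq B] (P : CoinFlip.Protocol A M B) (hP : P.IsWCF)
    (δ : ℝ) (hδ : 0 < δ) :
    (∃ β α : ℝ≥0, (β : ℝ) = P.optB + δ ∧ (α : ℝ) = P.optA + δ ∧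
      ∃ (m : ℕ) (p : ℕ → ℝ≥0 × ℝ≥0 → ℝ), CoinFlip.IsEBMPointGame m p β α) ∧
    (∃ β α : ℝ≥0, (β : ℝ) = P.optBEarly + δ ∧ (α : ℝ) = P.optA + δ ∧
      ∃ (ZA : ℕ → Matrix A A ℂ) (ZB : ℕ → Matrix B B ℂ),
        P.IsDualFeasibleA ZA β ∧ P.IsDualFeasibleB ZB α ∧
        CoinFlip.IsEBMPointGame P.n
          (fun i => CoinFlip.prob₂ (ZA (P.n - i)) (ZB (P.n - i)) (P.honest (P.n - i))) β α) := by
  have hB0 := hP.optB_nonneg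
  have hE0 := hP.optBEarly_nonneg
  have hA0 := hP.optA_nonneg
  constructor
  · obtain ⟨p, hp⟩ := hP.exists_isEBMPointGame (β := ⟨P.optB + δ, by positivity⟩)
      (α := ⟨P.optA + δ, by positivity⟩) (lt_add_of_pos_right _ hδ) (lt_add_of_pos_right _ hδ)
    exact ⟨_, _, rfl, rfl, P.n, p, hp⟩
  · let β : ℝ≥0 := ⟨P.optBEarly + δ, by positivity⟩
    let α : ℝ≥0 := ⟨P.optA + δ, by positivity⟩
    obtain ⟨ZA, hA, hAs⟩ := hP.exists_isDualFeasibleA (β := (β : ℝ)) (lt_add_of_pos_right _ hδ)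
    obtain ⟨ZB, hB, hBs⟩ := hP.exists_isDualFeasibleB (α := (α : ℝ)) (lt_add_of_pos_right _ hδ)
    refine ⟨β, α, rfl, rfl, ZA, ZB, hA, hB, ⟨fun i _ z => CoinFlip.prob₂_nonneg _ _ _ z,
      fun i _ => CoinFlip.finite_support_prob₂ _ _ _, ?_, fun i hi hie => ?_, fun i hi hio => ?_,
      ?_⟩⟩
    · rw [Nat.sub_zero, hA.last, hB.last, hP.prob₂_init]
    · exact hP.ebmVertical_of_dual hB hBs
        (fun k hk hkn => hA.even_step (k + 1) hk (Nat.succ_pos k) hkn) hi hie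
    · exact hP.ebmHorizontal_of_strict hB hi hio (hA.posSemidef _ (by omega))
        fun k hk hko => hAs k hko (by omega)
    · rw [Nat.sub_self]
      exact hP.prob₂_final (hA.posSemidef 0 (by omega)).isHermitian
        (hB.posSemidef 0 (by omega)).isHermitian hA.eigen hB.eigen
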